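/- Let $A=(a_{ij})_{i,j\in I}$ be a generalized Cartan matrix, i.e. an integer matrix with $a_{ii}=2$, $a_{ij}\le 0$ for $i\neq j$, and $a_{ij}=0\Leftrightarrow a_{ji}=0$; if $I$ is infinite, assume that each row has only finitely many nonzero entries. Let $\mathcal R$ be a Poisson algebra over $\mathbb C$ (a commutative $\mathbb C$-algebra with a skew-symmetric bilinear bracket $\{\,,\}$ satisfying the Leibniz rule and the Jacobi identity) with invertible elements $\varphi_i$ $(i\in I)$ satisfying the Serre relations $$\mathrm{ad}(\varphi_i)^{1-a_{ij}}(\varphi_j)=0\quad(i\neq j),\qquad \mathrm{ad}(f)=\{f,\cdot\}.$$ Let $\mathcal R[[\lambda]]$ be the ring of formal power series in variables $\lambda=(\lambda_i)_{i\in I}$ over $\mathcal R$, let $X_i=\varphi_i^{-1}\mathrm{ad}(\varphi_i)$ act on it coefficientwise, and for $t\in\mathcal R[[\lambda]]$ a linear form in the $\lambda_j$ with integer coefficients put $R_i(t)=\exp(tX_i)$. Let $r_i$ be the continuous $\mathcal R$-algebra endomorphism of $\mathcal R[[\lambda]]$ with $r_i(\lambda_j)=\lambda_j-a_{ji}\lambda_i$,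 and set $s_i=R_i(\lambda_i)\circ r_i$. Extend $s_i$ to an algebra endomorphism of the ring of Laurent polynomials $\mathcal R[[\lambda]][\tau^{\pm1}]=\mathcal R[[\lambda]][\tau_j^{\pm1}\,(j\in I)]$ by $$s_i(\tau_j)=\tau_j\ (j\neq i),\qquad s_i(\tau_i)=\varphi_i\,\tau_i\prod_{k\in I}\tau_k^{-a_{ki}}.$$ Then the $s_i$ are automorphisms of $\mathcal R[[\lambda]][\tau^{\pm1}]$ and satisfy the fundamental relations of the Weyl group $W(A)$: $$s_i^2=1,\qquad (s_is_j)^{m_{ij}}=1\quad(i\neq j),$$ where $m_{ij}=2,3,4,6,\infty$ according as $a_{ij}a_{ji}=0,1,2,3,\ge 4$ (no relation if $m_{ij}=\infty$). Moreover, for $i\ne j$, with $a=\lambda_i$ and $b=\lambda_j$, the following Yang–Baxter equations hold for operators on $\mathcal R[[\lambda]]$: - if $(a_{ij},a_{ji})=(0,0)$: $R_i(a)R_j(b)=R_j(b)R_i(a)$; - if $(a_{ij},a_{ji})=(-1,-1)$: $R_i(a)R_j(a+b)R_i(b)=R_j(b)R_i(a+b)R_j(a)$; - if $(a_{ij},a_{ji})=(-2,-1)$: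 $R_i(a)R_j(a+b)R_i(a+2b)R_j(b)=R_j(b)R_i(a+2b)R_j(a+b)R_i(a)$; - if $(a_{ij},a_{ji})=(-3,-1)$: $R_i(a)R_j(a+b)R_i(2a+3b)R_j(a+2b)R_i(a+3b)R_j(b)=R_j(b)R_i(a+3b)R_j(a+2b)R_i(2a+3b)R_j(a+b)R_i(a)$. -/

import Mathlib

noncomputable section

/-- Generalized Cartan matrices; over an infinite index set, locally finite ones. -/
structure IsGCM {I : Type*} (A : Matrix I I ℤ) : Prop where
  diag : ∀ i, A i i = 2
  nonpos : ∀ i j, i ≠ j → A i j ≤ 0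
  zero_iff : ∀ i j, A i j = 0 ↔ A j i = 0
  locallyFinite : ∀ i, {j | A i j ≠ 0}.Finite

/-- The exponent `m_ij` of the Weyl group, as a function of `a_ij * a_ji`. -/
def coxeterExponent (n : ℤ) : ℕ∞ :=
  if n = 0 then 2 else if n = 1 then 3 else if n = 2 then 4 else if n = 3 then 6 else ⊤

/-- A Poisson bracket on a commutative `ℂ`-algebra. (The Leibniz rule in the first argument
follows from the one in the second argument by skew-symmetry.) -/
structure PoissonBracket (R : Type*) [CommRing R] [Algebra ℂ R] where
  bracket : R →ₗ[ℂ] R →ₗ[ℂ] R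
  skew : ∀ f g, bracket f g = -bracket g f
  leibniz : ∀ f g h, bracket f (g * h) = bracket f g * h + g * bracket f h
  jacobi : ∀ f g h,
    bracket f (bracket g h) + bracket g (bracket h f) + bracket h (bracket f g) = 0

namespace PoissonWeyl

open MvPowerSeries Finset

variable {I R : Type*} [CommRing R] [Algebra ℂ R]

/-- The adjoint action `ad f = {f, ·}`, a derivation of `R`. -/
def ad (P : PoissonBracket R) (f : R) : Derivation ℂ R R :=
  Derivation.mk' (P.bracket f) fun g h => by
    rw [P.leibniz, smul_eq_mul, smul_eq_mul]; ring

/-- The Serre relations `ad(φ_i) ^ (1 - a_ij) (φ_j) = 0` for `i ≠ j`. -/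
def SerreRelations (P : PoissonBracket R) (A : Matrix I I ℤ) (φ : I → Rˣ) : Prop :=
  ∀ i j, i ≠ j → (ad P (φ i))^[(1 - A i j).toNat] (φ j : R) = 0

/-- The extension of a derivation of `R` to `R[[λ]]`, acting on coefficients
(so that it kills the variables `λ_j`). -/
def coeffDer (D : Derivation ℂ R R) :
    Derivation ℂ (MvPowerSeries I R) (MvPowerSeries I R) :=
  Derivation.mk'
    { toFun := fun f => fun d => D (coeff d f)
      map_add' := fun f g => by ext d; exact map_add D _ _
      map_smul' := fun c f => by ext d; exact D.map_smul c _ }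
    fun f g => by
      classical
      ext d
      change D (coeff d (f * g)) = coeff d (f * _ + g * _)
      rw [mul_comm g, map_add, coeff_mul, coeff_mul, coeff_mul, map_sum, ← sum_add_distrib]
      refine sum_congr rfl fun p _ => ?_
      rw [Derivation.leibniz, smul_eq_mul, smul_eq_mul, mul_comm (coeff p.2 g)]
      rfl

/-- The derivation `X_i = φ_i⁻¹ ad(φ_i)` of `R[[λ]]`. -/
def vectorField (P : PoissonBracket R) (u : Rˣ) :
    Derivation ℂ (MvPowerSeries I R) (MvPowerSeries I R) :=
  coeffDer (((u⁻¹ : Rˣ) : R) • ad P u)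

/-- The exponential `∑ n, E ^ n / n!` of an operator `E` on `R[[λ]]` that raises the total degree
in `λ`: only the terms with `n ≤ |d|` contribute to the coefficient of `λ ^ d`. -/
def formalExp (E : Module.End ℂ (MvPowerSeries I R)) : Module.End ℂ (MvPowerSeries I R) where
  toFun f := fun d => ∑ n ∈ range (d.degree + 1), (n.factorial : ℂ)⁻¹ • coeff d ((E ^ n) f)
  map_add' f g := by
    ext d
    change ∑ n ∈ range (d.degree + 1), (n.factorial : ℂ)⁻¹ • coeff d ((E ^ n) (f + g)) =
      (∑ n ∈ range (d.degree + 1), (n.factorial : ℂ)⁻¹ • coeff d ((E ^ n) f)) +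
        ∑ n ∈ range (d.degree + 1), (n.factorial : ℂ)⁻¹ • coeff d ((E ^ n) g)
    rw [← sum_add_distrib]
    refine sum_congr rfl fun n _ => ?_
    rw [map_add, map_add, smul_add]
  map_smul' c f := by
    ext d
    change ∑ n ∈ range (d.degree + 1), (n.factorial : ℂ)⁻¹ • coeff d ((E ^ n) (c • f)) =
      c • ∑ n ∈ range (d.degree + 1), (n.factorial : ℂ)⁻¹ • coeff d ((E ^ n) f)
    rw [smul_sum]
    refine sum_congr rfl fun n _ => ?_
    rw [map_smul, smul_comm c]
    rfl

/-- The operator `R_i(t) = exp(t X_i)` on `R[[λ]]`, for `t` without constant term. -/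
def rOperator (P : PoissonBracket R) (φ : I → Rˣ) (i : I) (t : MvPowerSeries I R) :
    Module.End ℂ (MvPowerSeries I R) :=
  formalExp (t • vectorField P (φ i)).toLinearMap

lemma coeff_formalExp (E : Module.End ℂ (MvPowerSeries I R)) (f : MvPowerSeries I R)
    (d : I →₀ ℕ) :
    coeff d (formalExp E f) =
      ∑ n ∈ range (d.degree + 1), (n.factorial : ℂ)⁻¹ • coeff d ((E ^ n) f) := rfl

/-- The terms dropped in `formalExp` vanish for `E = t D` with `t` without constant term. -/
lemma coeff_pow_eq_zero (D : Derivation ℂ R R) {t : MvPowerSeries I R}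
    (ht : constantCoeff t = 0) (f : MvPowerSeries I R) (n : ℕ) (d : I →₀ ℕ) (hd : d.degree < n) :
    coeff d ((((t • coeffDer D).toLinearMap : Module.End ℂ (MvPowerSeries I R)) ^ n) f) = 0 := by
  classical
  induction n generalizing d with
  | zero => omega
  | succ n ih =>
    rw [pow_succ', Module.End.mul_apply]
    set g := (((t • coeffDer D).toLinearMap : Module.End ℂ (MvPowerSeries I R)) ^ n) f
    change coeff d (t * coeffDer D g) = 0
    rw [coeff_mul]
    refine sum_eq_zero fun p hp => ?_
    rw [HasAntidiagonal.mem_antidiagonal] at hp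
    by_cases h : p.1 = 0
    · rw [h, coeff_zero_eq_constantCoeff_apply, ht, zero_mul]
    · have h1 : 0 < p.1.degree := by
        rw [pos_iff_ne_zero]
        exact fun h0 => h ((Finsupp.degree_eq_zero_iff _).1 h0)
      have h2 : p.1.degree + p.2.degree = d.degree := by rw [← hp, map_add]
      have h3 : coeff p.2 (coeffDer D g) = 0 := by
        change D (coeff p.2 g) = 0
        rw [ih p.2 (by omega), map_zero]
      rw [h3, mul_zero]

/-- The exponential of a derivation that raises the degree is multiplicative. -/
lemma formalExp_mul (E : Derivation ℂ (MvPowerSeries I R) (MvPowerSeries I R))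
    (hE : ∀ f n (d : I →₀ ℕ), d.degree < n →
      coeff d (((E.toLinearMap : Module.End ℂ (MvPowerSeries I R)) ^ n) f) = 0)
    (f g : MvPowerSeries I R) :
    formalExp E.toLinearMap (f * g) =
      formalExp E.toLinearMap f *
        formalExp (E : Module.End ℂ (MvPowerSeries I R)) g := by
  classical
  set F : Module.End ℂ (MvPowerSeries I R) := E.toLinearMap with hF
  have leib : ∀ n : ℕ, ((n.factorial : ℂ)⁻¹) • (F ^ n) (f * g) =
      ∑ p ∈ antidiagonal n, ((p.1.factorial : ℂ)⁻¹ • (F ^ p.1) f) * ((p.2.factorial : ℂ)⁻¹ • (F ^ p.2) g) := by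
    have raw : ∀ n : ℕ, (F ^ n) (f * g) =
        ∑ p ∈ antidiagonal n, n.choose p.1 • ((F ^ p.1) f * (F ^ p.2) g) := by
      intro n
      induction n with
      | zero => simp
      | succ n ih =>
        rw [sum_antidiagonal_choose_succ_nsmul (fun i j => (F ^ i) f * (F ^ j) g) n]
        rw [pow_succ', Module.End.mul_apply, ih, map_sum, ← sum_add_distrib]
        refine sum_congr rfl fun p hp => ?_
        have e : F ((F ^ p.1) f * (F ^ p.2) g) =
            (F ^ p.1) f * (F ^ (p.2 + 1)) g + (F ^ (p.1 + 1)) f * (F ^ p.2) g := by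
          rw [pow_succ' F p.2, pow_succ' F p.1, Module.End.mul_apply, Module.End.mul_apply, hF]
          change E _ = _ * E _ + E _ * _
          rw [Derivation.leibniz, smul_eq_mul, smul_eq_mul, mul_comm ((F ^ p.2) g)]
        rw [map_nsmul, e, smul_add, n.choose_symm_of_eq_add (mem_antidiagonal.1 hp).symm]
    intro n
    rw [raw, smul_sum]
    refine sum_congr rfl fun p hp => ?_
    have hpn := mem_antidiagonal.1 hp
    rw [smul_mul_smul_comm, ← Nat.cast_smul_eq_nsmul ℂ, smul_smul]
    congr 1
    have h := Nat.choose_mul_factorial_mul_factorial (show p.1 ≤ n by omega)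
    rw [show n - p.1 = p.2 by omega] at h
    have h' : ((n.choose p.1 : ℂ)) * (p.1.factorial : ℂ) * (p.2.factorial : ℂ) = (n.factorial : ℂ) := by exact_mod_cast h
    have a1 : (p.1.factorial : ℂ) ≠ 0 := by exact_mod_cast Nat.factorial_ne_zero _
    have a2 : (p.2.factorial : ℂ) ≠ 0 := by exact_mod_cast Nat.factorial_ne_zero _
    have a3 : (n.factorial : ℂ) ≠ 0 := by exact_mod_cast Nat.factorial_ne_zero _
    field_simp
    rw [← h']
  have trunc : ∀ (h : MvPowerSeries I R) (d : I →₀ ℕ) (N : ℕ), d.degree ≤ N →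
      coeff d (formalExp F h) = coeff d (∑ n ∈ range (N + 1), (n.factorial : ℂ)⁻¹ • (F ^ n) h) := by
    intro h d N hN
    rw [coeff_formalExp, map_sum]
    refine sum_subset_zero_on_sdiff (range_mono (by omega)) (fun n hn => ?_) fun n _ => rfl
    rw [mem_sdiff, mem_range, mem_range] at hn
    change (n.factorial : ℂ)⁻¹ • coeff d ((F ^ n) h) = 0
    rw [hE h n d (by omega), smul_zero]
  ext d
  have hR : coeff d (formalExp F f * formalExp F g) =
      coeff d ((∑ n ∈ range (d.degree + 1), (n.factorial : ℂ)⁻¹ • (F ^ n) f) *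
        (∑ n ∈ range (d.degree + 1), (n.factorial : ℂ)⁻¹ • (F ^ n) g)) := by
    rw [coeff_mul, coeff_mul]
    refine sum_congr rfl fun p hp => ?_
    rw [HasAntidiagonal.mem_antidiagonal] at hp
    have h2 : p.1.degree + p.2.degree = d.degree := by rw [← hp, map_add]
    rw [trunc f p.1 d.degree (by omega), trunc g p.2 d.degree (by omega)]
  rw [hR, trunc (f * g) d d.degree le_rfl]
  simp only [leib]
  rw [sum_mul_sum, ← sum_product', sum_sigma', map_sum, map_sum]
  symm
  refine sum_bij_ne_zero (fun p _ _ => ⟨p.1 + p.2, p⟩) ?_ ?_ ?_ ?_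
  · intro p hp hne
    simp only [mem_sigma, mem_range, HasAntidiagonal.mem_antidiagonal, and_true]
    by_contra hlt
    apply hne
    rw [coeff_mul]
    refine sum_eq_zero fun q hq => ?_
    rw [HasAntidiagonal.mem_antidiagonal] at hq
    have h2 : q.1.degree + q.2.degree = d.degree := by rw [← hq, map_add]
    change ((p.1.factorial : ℂ)⁻¹ • coeff q.1 ((F ^ p.1) f)) * ((p.2.factorial : ℂ)⁻¹ • coeff q.2 ((F ^ p.2) g)) = 0
    rcases lt_or_ge q.1.degree p.1 with h | h
    · rw [hE f _ _ h, smul_zero, zero_mul]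
    · rw [hE g _ q.2 (by omega), smul_zero, mul_zero]
  · intro p _ _ q _ _ h
    exact eq_of_heq (Sigma.mk.inj_iff.1 h).2
  · rintro ⟨n, p⟩ hp hne
    simp only [mem_sigma, mem_range, HasAntidiagonal.mem_antidiagonal] at hp
    refine ⟨p, ?_, hne, ?_⟩
    · rw [mem_product, mem_range, mem_range]; omega
    · obtain ⟨_, rfl⟩ := hp; rfl
  · intro p _ _; rfl

lemma formalExp_one (E : Derivation ℂ (MvPowerSeries I R) (MvPowerSeries I R)) :
    formalExp E.toLinearMap 1 = 1 := by
  ext d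
  rw [coeff_formalExp, sum_range_succ', sum_eq_zero, zero_add]
  · simp
  · intro n _
    rw [pow_succ, Module.End.mul_apply]
    have h : E.toLinearMap (1 : MvPowerSeries I R) = 0 := E.map_one_eq_zero
    rw [h, map_zero, map_zero, smul_zero]

/-- `R_i(λ_i)` as an algebra homomorphism. -/
def rHom (P : PoissonBracket R) (φ : I → Rˣ) (i : I) :
    MvPowerSeries I R →ₐ[ℂ] MvPowerSeries I R :=
  AlgHom.ofLinearMap (rOperator P φ i (X i)) (formalExp_one _)
    (formalExp_mul _ fun f n d hd => coeff_pow_eq_zero _ (constantCoeff_X i) f n d hd)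

lemma IsGCM_column_finite {A : Matrix I I ℤ} (hA : IsGCM A) (i : I) :
    {j | A j i ≠ 0}.Finite :=
  (hA.locallyFinite i).subset fun j hj h => hj ((hA.zero_iff i j).1 h)

lemma hasSubst_reflection {R : Type*} [CommRing R] {A : Matrix I I ℤ} (hA : IsGCM A) (i : I) :
    HasSubst fun j => (X j - A j i • X i : MvPowerSeries I R) where
  const_coeff j := by simp
  coeff_zero d := by
    have h1 : {j | coeff d (X j : MvPowerSeries I R) ≠ 0}.Finite := HasSubst.X.coeff_zero d
    refine (h1.union (IsGCM_column_finite hA i)).subset fun j hj => ?_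
    by_contra hc
    simp only [Set.mem_union, Set.mem_ofPred_eq, not_or, not_not] at hc
    exact hj (by rw [map_sub, hc.1, hc.2, zero_smul, map_zero, sub_zero])

/-- The continuous `R`-linear algebra homomorphism `r_i` of `R[[λ]]` with
`r_i(λ_j) = λ_j - a_ji λ_i`. -/
def reflection {A : Matrix I I ℤ} (hA : IsGCM A) (i : I) :
    MvPowerSeries I R →ₐ[R] MvPowerSeries I R :=
  substAlgHom (hasSubst_reflection hA i)

/-- `s_i = exp(λ_i X_i) ∘ r_i` on `R[[λ]]`. -/
def weylSeries (P : PoissonBracket R) {A : Matrix I I ℤ} (hA : IsGCM A) (φ : I → Rˣ) (i : I) :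
    MvPowerSeries I R →ₐ[ℂ] MvPowerSeries I R :=
  (rHom P φ i).comp ((reflection hA i).restrictScalars ℂ)

/-- The ring `R[[λ]][τ^{±1}]` of Laurent polynomials, as the group ring of the free abelian group
with basis `I`; the basis vector of `i` is the exponent of `τ_i`. -/
abbrev Laurent (I R : Type*) [CommRing R] : Type _ :=
  AddMonoidAlgebra (MvPowerSeries I R) (I →₀ ℤ)

/-- The variable `τ_j`, as an invertible element; so `τ_j ^ n` makes sense for all integers `n`. -/
def tau (j : I) : (Laurent I R)ˣ where
  val := AddMonoidAlgebra.single (Finsupp.single j 1) 1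
  inv := AddMonoidAlgebra.single (-Finsupp.single j 1) 1
  val_inv := by simp [AddMonoidAlgebra.single_mul_single, AddMonoidAlgebra.one_def]
  inv_val := by simp [AddMonoidAlgebra.single_mul_single, AddMonoidAlgebra.one_def]

open Classical in
/-- The image `s_i(τ_j)`: it is `τ_j` for `j ≠ i`, and `φ_i τ_i ∏ k, τ_k ^ (-a_ki)` for `j = i`. -/
def tauImage {A : Matrix I I ℤ} (hA : IsGCM A) (φ : I → Rˣ) (i j : I) : (Laurent I R)ˣ :=
  if j = i then
    Units.map (algebraMap R (Laurent I R) : R →* Laurent I R) (φ i) *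
      (tau i : (Laurent I R)ˣ) *
      ∏ k ∈ (IsGCM_column_finite hA i).toFinset, (tau k : (Laurent I R)ˣ) ^ (-A k i)
  else tau j

/-- The action of `s_i` on the Laurent monomials in the `τ_j`. -/
def monomialImage {A : Matrix I I ℤ} (hA : IsGCM A) (φ : I → Rˣ) (i : I) :
    Multiplicative (I →₀ ℤ) →* (Laurent I R)ˣ where
  toFun Λ := Λ.toAdd.prod fun j n => tauImage hA φ i j ^ n
  map_one' := Finsupp.prod_zero_index
  map_mul' _ _ := Finsupp.prod_add_index' (fun _ => zpow_zero _) fun _ _ _ => zpow_add _ _ _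

/-- The algebra endomorphism `s_i` of `R[[λ]][τ^{±1}]`. -/
def weyl (P : PoissonBracket R) {A : Matrix I I ℤ} (hA : IsGCM A) (φ : I → Rˣ) (i : I) :
    Laurent I R →ₐ[ℂ] Laurent I R :=
  AddMonoidAlgebra.liftNCAlgHom
    (((Algebra.ofId (MvPowerSeries I R) (Laurent I R)).restrictScalars ℂ).comp
      (weylSeries P hA φ i))
    ((Units.coeHom _).comp (monomialImage hA φ i)) fun _ _ => Commute.all _ _

/-- On coefficients, `s_i` is the given endomorphism of `R[[λ]]`. -/
lemma weyl_algebraMap (P : PoissonBracket R) {A : Matrix I I ℤ} (hA : IsGCM A) (φ : I → Rˣ)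
    (i : I) (f : MvPowerSeries I R) :
    weyl P hA φ i (algebraMap _ (Laurent I R) f) = algebraMap _ _ (weylSeries P hA φ i f) := by
  have h : algebraMap (MvPowerSeries I R) (Laurent I R) f = AddMonoidAlgebra.single 0 f := rfl
  rw [h, weyl, AddMonoidAlgebra.coe_liftNCAlgHom, AddMonoidAlgebra.liftNC_single]
  change algebraMap (MvPowerSeries I R) (Laurent I R) (weylSeries P hA φ i f) * ((monomialImage hA φ i 1 : (Laurent I R)ˣ) : Laurent I R) = _
  rw [map_one, Units.val_one, mul_one]

lemma weyl_tau (P : PoissonBracket R) {A : Matrix I I ℤ} (hA : IsGCM A) (φ : I → Rˣ) (i j : I) :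
    weyl P hA φ i ((tau j : (Laurent I R)ˣ) : Laurent I R) =
      ((tauImage hA φ i j : (Laurent I R)ˣ) : Laurent I R) := by
  have h : ((tau j : (Laurent I R)ˣ) : Laurent I R) =
    AddMonoidAlgebra.single (Finsupp.single j 1) 1 := rfl
  rw [h, weyl, AddMonoidAlgebra.coe_liftNCAlgHom, AddMonoidAlgebra.liftNC_single]
  change algebraMap (MvPowerSeries I R) (Laurent I R) (weylSeries P hA φ i 1) *
    ((monomialImage hA φ i (Multiplicative.ofAdd (Finsupp.single j 1)) : (Laurent I R)ˣ) :
      Laurent I R) = _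
  rw [map_one, map_one, one_mul]
  congr 1
  change (Finsupp.single j (1 : ℤ)).prod _ = _
  rw [Finsupp.prod_single_index (zpow_zero _), zpow_one]

end PoissonWeyl

end

/-!
Give `R[[λ]][τ^{±1}]` the bracket that extends the one of `R` with `{log τ_j, λ_k} = δ_jk`. Then
`s_i` is a Poisson automorphism, and it is determined by what it does to Hamiltonian derivations of
monomials. Precisely, the monomial `g = u τ^v`, with `u` a unit of `R[[λ]]`, acts on `R[[λ]]` by
the derivation `D_g = {log g, ·} = u⁻¹ {u, ·} + ∑ k, v_k ∂/∂λ_k` (`hamiltonian`), and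
`s_i D_g = D_{s_i(g)} s_i` (`monomialAction_compatible`); for `g = τ_i` this is the differential
equation in `λ_i` that `exp(λ_i X_i)` satisfies. Consequently a word in the `s_i` that fixes every
`τ_k` commutes with all `∂/∂λ_k`; as it also preserves constant terms, it is the identity on
`R[[λ]]` (`IsCompatible.series_eq_one`), hence on the whole ring. So the relations of the Weyl
group have to be checked on the `τ_k` only.

For `s_i² = 1` this is immediate, as it is for `(s_i s_j)² = 1` when `a_ij = a_ji = 0`. Otherwise
`a_ji = -1` up to an exchange of `i` and `j`, and the two alternating words of length `m = m_ij`
are compared on `τ_i`: each step takes place in the subalgebra generated by `λ_i`, `λ_j` and the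
iterated brackets of `φ_i` and `φ_j`, where by the Serre relations the exponentials are
polynomials, and the last letter acts trivially by an explicit polynomial identity
(`RankTwoAction`, `IsWalk`). The variable `τ_j`, whose orbit would lead to far larger polynomials
in type `G₂`, needs no such computation: the word fixes `φ_i τ_j` as a consequence of its fixing
`τ_i` and `s_i(τ_i)`, and then the uniqueness principle `eq_zero_of_pderiv` shows that it fixes
`φ_i` (`IsCompatible.tauMonomial_fixed`).

The Yang-Baxter equations are the braid relations of the `s_i = R_i(λ_i) r_i` on `R[[λ]]`, after
the reflections are moved to the right by `r_i R_k(t) = R_k(r_i(t)) r_i` (`reflection_rOperator`)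
and cancelled. The braid relations of the `r_i` needed here are those of the `s_i` for the zero
bracket.
-/

noncomputable section

namespace PoissonWeyl

open MvPowerSeries Finset

section

/-! ### Power series determined by their derivatives -/

variable {I R : Type*} [CommRing R]

/-- The ideal of the power series of order at least `n` for the total degree in `λ`. -/
def orderIdeal (I R : Type*) [CommRing R] (n : ℕ) : Ideal (MvPowerSeries I R) where
  carrier := {f | ∀ d : I →₀ ℕ, d.degree < n → coeff d f = 0}
  zero_mem' := fun d _ => map_zero _
  add_mem' := fun hf hg d hd => by rw [map_add, hf d hd, hg d hd, add_zero]
  smul_mem' := fun c f hf d hd => by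
    classical
    rw [smul_eq_mul, coeff_mul]
    refine sum_eq_zero fun p hp => ?_
    have h : p.1.degree + p.2.degree = d.degree := by
      rw [← HasAntidiagonal.mem_antidiagonal.1 hp, map_add]
    rw [hf p.2 (by omega), mul_zero]

lemma pderiv_mem_orderIdeal {n : ℕ} {f : MvPowerSeries I R} (hf : f ∈ orderIdeal I R (n + 1))
    (k : I) : pderiv R k f ∈ orderIdeal I R n := fun d hd => by
  rw [coeff_pderiv, hf _ (by rw [map_add, Finsupp.degree_single]; omega), zero_mul]

/-- In characteristic zero, a series without constant term whose partial derivatives have order at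
least `n` has order at least `n + 1`. -/
lemma mem_orderIdeal_succ [Algebra ℂ R] {n : ℕ} {f : MvPowerSeries I R} (h0 : constantCoeff f = 0)
    (h : ∀ k, pderiv R k f ∈ orderIdeal I R n) : f ∈ orderIdeal I R (n + 1) := fun d hd => by
  by_cases hd0 : d = 0
  · rw [hd0, coeff_zero_eq_constantCoeff_apply, h0]
  obtain ⟨k, hk⟩ := Finsupp.ne_iff.1 hd0
  have hle : Finsupp.single k 1 ≤ d := by
    rw [Finsupp.single_le_iff]; exact Nat.one_le_iff_ne_zero.2 hk
  obtain ⟨e, rfl⟩ := exists_add_of_le hle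
  rw [add_comm] at hd ⊢
  have h1 := h k e (by rw [map_add, Finsupp.degree_single] at hd; omega)
  rw [coeff_pderiv] at h1
  have h2 : ((e k : ℂ) + 1) • coeff (e + Finsupp.single k 1) f = 0 := by
    rw [Algebra.smul_def, map_add, map_natCast, map_one, mul_comm]; exact h1
  exact (smul_eq_zero_iff_right (Nat.cast_add_one_ne_zero _)).1 h2

/-- The uniqueness principle behind all identities of operators below: a family of power series
without constant terms vanishes if the derivatives of its members have at least the order that all
of its members have. This is typically applied to the family `f ↦ F f - G f` for two operators `F`,
`G`, when each `∂ (F f - G f)` is a combination of members of the family. -/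
lemma eq_zero_of_pderiv [Algebra ℂ R] {ι : Type*} (H : ι → MvPowerSeries I R)
    (h0 : ∀ x, constantCoeff (H x) = 0)
    (h1 : ∀ n, (∀ x, H x ∈ orderIdeal I R n) → ∀ x k, pderiv R k (H x) ∈ orderIdeal I R n)
    (x : ι) : H x = 0 := by
  have h : ∀ n x, H x ∈ orderIdeal I R n := fun n => by
    induction n with
    | zero => exact fun x d hd => absurd hd (Nat.not_lt_zero _)
    | succ n ih => exact fun x => mem_orderIdeal_succ (h0 x) (h1 n ih x)
  ext d
  exact h (d.degree + 1) x d (Nat.lt_succ_self _)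

/-- Two continuous operators on `R[[λ]]`, for the product topology of the discrete topology on `R`,
agree if they agree on polynomials. -/
lemma ext_of_polynomial {F G : MvPowerSeries I R → MvPowerSeries I R}
    (hF : let : UniformSpace R := ⊥; let := WithPiTopology.instTopologicalSpace (σ := I) R
      Continuous F)
    (hG : let : UniformSpace R := ⊥; let := WithPiTopology.instTopologicalSpace (σ := I) R
      Continuous G)
    (h : ∀ p : MvPolynomial I R, F p = G p) (f : MvPowerSeries I R) : F f = G f := by
  let : UniformSpace R := ⊥
  let := WithPiTopology.instTopologicalSpace (σ := I) R
  have : DiscreteTopology R := inferInstance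
  have : T2Space (MvPowerSeries I R) := WithPiTopology.instT2Space
  exact congrFun (DenseRange.equalizer WithPiTopology.denseRange_toMvPowerSeries hF hG
    (funext fun p => h p)) f

/-! ### The reflections of the variables -/

lemma reflection_X {A : Matrix I I ℤ} (hA : IsGCM A) (i j : I) :
    reflection hA i (X j : MvPowerSeries I R) = X j - A j i • X i :=
  substAlgHom_X _ _

lemma reflection_C {A : Matrix I I ℤ} (hA : IsGCM A) (i : I) (r : R) :
    reflection hA i (C r : MvPowerSeries I R) = C r :=
  (reflection hA i).commutes r

lemma constantCoeff_reflection {A : Matrix I I ℤ} (hA : IsGCM A) (i : I)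
    (f : MvPowerSeries I R) : constantCoeff (reflection hA i f) = constantCoeff f := by
  have h : reflection hA i (f - C (constantCoeff f)) ∈ orderIdeal I R 1 := by
    have := constantCoeff_subst_eq_zero (hasSubst_reflection (R := R) hA i) (by simp)
      (f := f - C (constantCoeff f)) (by simp)
    intro d hd
    have hd0 : d = 0 := (Finsupp.degree_eq_zero_iff _).1 (by omega)
    rw [hd0, coeff_zero_eq_constantCoeff_apply]
    rw [reflection, substAlgHom_apply]
    exact this
  have := h 0 (by simp)
  rw [map_sub, reflection_C, map_sub, coeff_zero_eq_constantCoeff_apply,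
    coeff_zero_eq_constantCoeff_apply, constantCoeff_C, sub_eq_zero] at this
  exact this

/-- The chain rule for the linear substitution `r_i`: only the derivative along `λ_i` is affected,
since `r_i(λ_j) - λ_j` is a multiple of `λ_i`. -/
lemma pderiv_reflection {A : Matrix I I ℤ} (hA : IsGCM A) (i k : I) (f : MvPowerSeries I R) :
    pderiv R k (reflection hA i f) = reflection hA i (pderiv R k f) -
      pderiv R k (X i) * ∑ j ∈ (IsGCM_column_finite hA i).toFinset,
        A j i • reflection hA i (pderiv R j f) := by
  classical
  revert f
  let : UniformSpace R := ⊥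
  let := WithPiTopology.instTopologicalSpace (σ := I) R
  have : DiscreteTopology R := inferInstance
  have : IsTopologicalRing (MvPowerSeries I R) := WithPiTopology.instIsTopologicalRing I R
  have hr : Continuous (reflection hA i : MvPowerSeries I R → MvPowerSeries I R) := by
    rw [reflection, coe_substAlgHom]
    exact continuous_subst (hasSubst_reflection (R := R) hA i)
  have hd : ∀ k, Continuous (pderiv R k : MvPowerSeries I R → MvPowerSeries I R) := fun k => by
    refine continuous_pi fun d => ?_
    exact (continuous_of_discreteTopology (f := fun r : R => r * (d k + 1))).comp
      (WithPiTopology.continuous_coeff R (d + Finsupp.single k 1))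
  refine ext_of_polynomial ((hd k).comp hr) ?_ fun p => ?_
  · refine (hr.comp (hd k)).sub (continuous_const.mul (continuous_finsetSum _ fun j _ => ?_))
    simp only [zsmul_eq_mul]
    exact continuous_const.mul (hr.comp (hd j))
  · induction p using MvPolynomial.induction_on with
    | C a => simp [reflection_C, MvPolynomial.coe_C]
    | add p q hp hq =>
      simp only [MvPolynomial.coe_add, map_add, hp, hq, smul_add, sum_add_distrib]; ring
    | mul_X p n hp =>
      simp only [MvPolynomial.coe_mul, MvPolynomial.coe_X, map_mul, Derivation.leibniz, hp,
        smul_eq_mul, map_add, reflection_X, map_sub, smul_add, sum_add_distrib]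
      have e1 : ∑ j ∈ (IsGCM_column_finite hA i).toFinset,
          A j i • (reflection hA i (p : MvPowerSeries I R) *
            reflection hA i (pderiv R j (X n : MvPowerSeries I R))) =
          A n i • reflection hA i (p : MvPowerSeries I R) := by
        rw [sum_eq_single n]
        · simp
        · intro j _ hj
          rw [pderiv_X_of_ne hj.symm, map_zero, mul_zero, smul_zero]
        · intro hn
          simp only [Set.Finite.mem_toFinset, Set.mem_ofPred_eq, not_not] at hn
          rw [hn, zero_smul]
      have e2 : reflection hA i (pderiv R k (X n : MvPowerSeries I R)) = pderiv R k (X n) := by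
        by_cases h : n = k
        · subst h; simp
        · simp [pderiv_X_of_ne h]
      have e3 : pderiv R k (A n i • (X i : MvPowerSeries I R)) = A n i • pderiv R k (X i) :=
        map_zsmul _ _ _
      rw [e1, e2, e3]
      simp only [zsmul_eq_mul, mul_sub, sub_mul, mul_sum]
      rw [← sub_eq_zero]
      simp only [mul_add, mul_sub, mul_sum]
      ring_nf

/-! ### Coefficientwise derivations -/

variable [Algebra ℂ R]

@[simp]
lemma coeff_coeffDer (D : Derivation ℂ R R) (f : MvPowerSeries I R) (d : I →₀ ℕ) :
    coeff d (coeffDer D f) = D (coeff d f) := rfl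

lemma coeffDer_mem_orderIdeal (D : Derivation ℂ R R) {n : ℕ} {f : MvPowerSeries I R}
    (hf : f ∈ orderIdeal I R n) : coeffDer D f ∈ orderIdeal I R n := fun d hd => by
  rw [coeff_coeffDer, hf d hd, map_zero]

lemma pderiv_coeffDer (D : Derivation ℂ R R) (k : I) (f : MvPowerSeries I R) :
    pderiv R k (coeffDer D f) = coeffDer D (pderiv R k f) := by
  ext d
  rw [coeff_pderiv, coeff_coeffDer, coeff_coeffDer, coeff_pderiv]
  have h : ((d k : R) + 1) = algebraMap ℂ R (d k + 1) := by simp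
  rw [h, mul_comm, mul_comm (coeff _ f), ← Algebra.smul_def, ← Algebra.smul_def, D.map_smul]

lemma pderiv_complex_smul (k : I) (c : ℂ) (f : MvPowerSeries I R) :
    pderiv R k (c • f) = c • pderiv R k f := by
  ext d
  change _ = c • coeff d (pderiv R k f)
  rw [coeff_pderiv, coeff_pderiv, ← smul_mul_assoc]
  rfl

/-! ### The Poisson bracket on power series -/

variable (P : PoissonBracket R)

open Classical in
/-- The coefficientwise extension of a Poisson bracket to `R[[λ]]`, with the `λ_j` central. -/
def bracketSeries :
    MvPowerSeries I R →ₗ[ℂ] MvPowerSeries I R →ₗ[ℂ] MvPowerSeries I R :=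
  LinearMap.mk₂ ℂ
    (fun f g => fun d => ∑ p ∈ antidiagonal d, P.bracket (coeff p.1 f) (coeff p.2 g))
    (fun f f' g => funext fun d => by
      simp only [map_add, LinearMap.add_apply, sum_add_distrib]; rfl)
    (fun c f g => funext fun d => by
      change _ = c • ∑ p ∈ antidiagonal d, P.bracket (coeff p.1 f) (coeff p.2 g)
      rw [smul_sum]
      exact sum_congr rfl fun p _ => LinearMap.map_smul₂ _ _ _ _)
    (fun f g g' => funext fun d => by simp only [map_add, sum_add_distrib]; rfl)
    (fun c f g => funext fun d => by
      change _ = c • ∑ p ∈ antidiagonal d, P.bracket (coeff p.1 f) (coeff p.2 g)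
      rw [smul_sum]
      exact sum_congr rfl fun p _ => map_smul _ _ _)

lemma coeff_bracketSeries [DecidableEq I] (f g : MvPowerSeries I R) (d : I →₀ ℕ) :
    coeff d (bracketSeries P f g) =
      ∑ p ∈ antidiagonal d, P.bracket (coeff p.1 f) (coeff p.2 g) := by
  have h : ‹DecidableEq I› = Classical.decEq I := Subsingleton.elim _ _
  subst h
  rfl

lemma constantCoeff_bracketSeries (f g : MvPowerSeries I R) :
    constantCoeff (bracketSeries P f g) = P.bracket (constantCoeff f) (constantCoeff g) := by
  classical
  rw [← coeff_zero_eq_constantCoeff_apply, coeff_bracketSeries, Finsupp.antidiagonal_zero,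
    sum_singleton]
  rfl

lemma bracketSeries_C (a : R) (f : MvPowerSeries I R) :
    bracketSeries P (C a) f = coeffDer (ad P a) f := by
  classical
  ext d
  rw [coeff_bracketSeries, sum_eq_single (0, d), coeff_zero_C]
  · rfl
  · intro p hp hne
    rw [coeff_C, if_neg, map_zero, LinearMap.zero_apply]
    rintro h
    rw [HasAntidiagonal.mem_antidiagonal, h, zero_add] at hp
    exact hne (Prod.ext h hp)
  · intro h
    exact absurd (HasAntidiagonal.mem_antidiagonal.2 (zero_add d)) h

/-- Reindexing of the sum that computes a coefficient of a derivative in one factor of a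
product. -/
lemma sum_antidiagonal_succ_single [DecidableEq I] {M : Type*} [AddCommGroup M] [Module ℂ M]
    (d : I →₀ ℕ) (k : I) (F : (I →₀ ℕ) → (I →₀ ℕ) → M) :
    ∑ p ∈ antidiagonal (d + Finsupp.single k 1), ((p : (I →₀ ℕ) × (I →₀ ℕ)).1 k : ℂ) • F p.1 p.2 =
      ∑ p ∈ antidiagonal d, ((p.1 k : ℂ) + 1) • F (p.1 + Finsupp.single k 1) p.2 := by
  symm
  refine sum_bij_ne_zero (fun p _ _ => (p.1 + Finsupp.single k 1, p.2)) ?_ ?_ ?_ ?_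
  · intro p hp _
    rw [HasAntidiagonal.mem_antidiagonal] at hp ⊢
    rw [← hp, add_right_comm]
  · intro p _ _ q _ _ h
    simp only [Prod.mk.injEq, add_left_inj] at h
    exact Prod.ext h.1 h.2
  · intro p hp hne
    have hk : Finsupp.single k 1 ≤ p.1 := by
      rw [Finsupp.single_le_iff, Nat.one_le_iff_ne_zero]
      intro h
      rw [h, Nat.cast_zero, zero_smul] at hne
      exact hne rfl
    obtain ⟨e, he⟩ := exists_add_of_le hk
    rw [HasAntidiagonal.mem_antidiagonal] at hp
    refine ⟨(e, p.2), ?_, ?_, ?_⟩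
    · rw [HasAntidiagonal.mem_antidiagonal]
      rw [he] at hp
      rw [← add_left_inj (Finsupp.single k 1), ← hp, add_comm (Finsupp.single k 1),
        add_right_comm]
    · rw [he, add_comm] at hne
      simpa using hne
    · exact Prod.ext (by rw [he, add_comm]) rfl
  · intro p _ _
    simp

lemma coeff_pderiv_smul (k : I) (f : MvPowerSeries I R) (d : I →₀ ℕ) :
    coeff d (pderiv R k f) = ((d k : ℂ) + 1) • coeff (d + Finsupp.single k 1) f := by
  rw [coeff_pderiv, Algebra.smul_def, map_add, map_natCast, map_one, mul_comm]

lemma pderiv_bracketSeries (k : I) (f g : MvPowerSeries I R) :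
    pderiv R k (bracketSeries P f g) =
      bracketSeries P (pderiv R k f) g + bracketSeries P f (pderiv R k g) := by
  classical
  ext d
  have h1 := sum_antidiagonal_succ_single d k fun p q => P.bracket (coeff p f) (coeff q g)
  have h2 := sum_antidiagonal_succ_single d k fun p q => P.bracket (coeff q f) (coeff p g)
  rw [Finsupp.sum_antidiagonal_swap _ fun p q => (p k : ℂ) • P.bracket (coeff q f) (coeff p g),
    Finsupp.sum_antidiagonal_swap _ fun p q => ((p k : ℂ) + 1) •
      P.bracket (coeff q f) (coeff (p + Finsupp.single k 1) g)] at h2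
  rw [map_add, coeff_bracketSeries, coeff_bracketSeries, coeff_pderiv_smul, coeff_bracketSeries]
  simp only [coeff_pderiv_smul, map_smul, LinearMap.smul_apply]
  rw [← h1, ← h2, ← sum_add_distrib, smul_sum]
  refine sum_congr rfl fun p hp => ?_
  have h := DFunLike.congr_fun (HasAntidiagonal.mem_antidiagonal.1 hp) k
  simp only [Finsupp.add_apply, Finsupp.single_eq_same] at h
  rw [← add_smul]
  congr 1
  exact_mod_cast h.symm

lemma PoissonBracket.leibniz_left (f g h : R) :
    P.bracket (f * g) h = f * P.bracket g h + g * P.bracket f h := by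
  rw [P.skew, P.leibniz, P.skew h f, P.skew h g]; ring

lemma bracketSeries_mul_left (f g h : MvPowerSeries I R) :
    bracketSeries P (f * g) h = f * bracketSeries P g h + g * bracketSeries P f h := by
  rw [← sub_eq_zero]
  refine eq_zero_of_pderiv
    (fun x : MvPowerSeries I R × MvPowerSeries I R × MvPowerSeries I R =>
      bracketSeries P (x.1 * x.2.1) x.2.2 -
        (x.1 * bracketSeries P x.2.1 x.2.2 + x.2.1 * bracketSeries P x.1 x.2.2)) ?_ ?_ (f, g, h)
  · rintro ⟨f, g, h⟩
    simp only [map_sub, map_add, map_mul, constantCoeff_bracketSeries]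
    rw [PoissonBracket.leibniz_left, sub_self]
  · rintro n hn ⟨f, g, h⟩ k
    convert add_mem (add_mem (hn (pderiv R k f, g, h)) (hn (f, pderiv R k g, h)))
      (hn (f, g, pderiv R k h)) using 1
    simp only [map_sub, map_add, pderiv_bracketSeries, Derivation.leibniz, smul_eq_mul,
      LinearMap.add_apply, mul_comm]
    ring

lemma vectorField_eq (u : Rˣ) (f : MvPowerSeries I R) :
    vectorField P u f = C ((u⁻¹ : Rˣ) : R) * bracketSeries P (C (u : R)) f := by
  rw [bracketSeries_C, ← smul_eq_C_mul]
  rfl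

lemma bracket_inv (u : Rˣ) (g : R) :
    P.bracket ((u⁻¹ : Rˣ) : R) g = -(((u⁻¹ : Rˣ) : R) ^ 2 * P.bracket u g) := by
  have h : P.bracket (((u⁻¹ : Rˣ) : R) * u) g = 0 := by
    rw [u.inv_mul, P.skew]
    exact neg_eq_zero.2 (ad P g).map_one_eq_zero
  rw [PoissonBracket.leibniz_left] at h
  linear_combination ((u⁻¹ : Rˣ) : R) * h - P.bracket ((u⁻¹ : Rˣ) : R) g * u.inv_mul

lemma vectorField_X (u : Rˣ) (k : I) : vectorField P u (X k : MvPowerSeries I R) = 0 := by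
  classical
  ext d
  rw [vectorField, coeff_coeffDer, coeff_X]
  split_ifs
  · rw [Derivation.map_one_eq_zero]; rfl
  · rw [map_zero]; rfl

/-- By the Jacobi identity `u⁻¹ {u, ·}`, the Hamiltonian derivation of `log u`, is a derivation of
the bracket. -/
lemma vectorField_bracketSeries (u : Rˣ) (f g : MvPowerSeries I R) :
    vectorField P u (bracketSeries P f g) =
      bracketSeries P (vectorField P u f) g + bracketSeries P f (vectorField P u g) := by
  rw [← sub_eq_zero]
  refine eq_zero_of_pderiv (fun x : MvPowerSeries I R × MvPowerSeries I R =>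
      vectorField P u (bracketSeries P x.1 x.2) - (bracketSeries P (vectorField P u x.1) x.2 +
        bracketSeries P x.1 (vectorField P u x.2))) ?_ ?_ (f, g)
  · rintro ⟨f, g⟩
    have e : ∀ f : MvPowerSeries I R, constantCoeff (vectorField P u f) =
      ((u⁻¹ : Rˣ) : R) * P.bracket u (constantCoeff f) := fun _ => rfl
    simp only [map_sub, map_add, constantCoeff_bracketSeries, e]
    set a := constantCoeff f
    set b := constantCoeff g
    rw [PoissonBracket.leibniz_left, P.leibniz, P.skew a ((u⁻¹ : Rˣ) : R), bracket_inv,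
      bracket_inv]
    have j := P.jacobi u a b
    rw [P.skew b (P.bracket u a), P.skew b u, map_neg] at j
    linear_combination ((u⁻¹ : Rˣ) : R) * j
  · rintro n hn ⟨f, g⟩ k
    convert add_mem (hn (pderiv R k f, g)) (hn (f, pderiv R k g)) using 1
    simp only [vectorField, map_sub, map_add, pderiv_bracketSeries, pderiv_coeffDer]
    ring

/-! ### Derivatives of the operators on power series -/

variable (φ : I → Rˣ)

lemma constantCoeff_formalExp (E : Module.End ℂ (MvPowerSeries I R)) (f : MvPowerSeries I R) :
    constantCoeff (formalExp E f) = constantCoeff f := by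
  rw [← coeff_zero_eq_constantCoeff_apply, coeff_formalExp]
  simp

/-- The commutator of `∂_k` with `(λ_i X_i) ^ n`, as `∂_k` and `λ_i` commute with `X_i`. -/
lemma pderiv_pow_smul_vectorField (i k : I) (n : ℕ) (f : MvPowerSeries I R) :
    pderiv R k ((((X i : MvPowerSeries I R) • vectorField P (φ i)).toLinearMap ^ n :
      Module.End ℂ (MvPowerSeries I R)) f) =
      (((X i : MvPowerSeries I R) • vectorField P (φ i)).toLinearMap ^ n :
        Module.End ℂ (MvPowerSeries I R)) (pderiv R k f) +
      (n : ℂ) • (pderiv R k (X i) * vectorField P (φ i)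
        ((((X i : MvPowerSeries I R) • vectorField P (φ i)).toLinearMap ^ (n - 1) :
          Module.End ℂ (MvPowerSeries I R)) f)) := by
  set E : Module.End ℂ (MvPowerSeries I R) :=
    ((X i : MvPowerSeries I R) • vectorField P (φ i)).toLinearMap with hE
  have hEa : ∀ f, E f = X i * vectorField P (φ i) f := fun _ => rfl
  have hc : ∀ f, pderiv R k (vectorField P (φ i) f) = vectorField P (φ i) (pderiv R k f) :=
    fun f => pderiv_coeffDer _ k f
  have hx : ∀ f : MvPowerSeries I R, vectorField P (φ i) (pderiv R k (X i) * f) =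
      pderiv R k (X i) * vectorField P (φ i) f := fun f => by
    by_cases h : i = k
    · subst h; simp
    · simp [pderiv_X_of_ne h]
  induction n with
  | zero => simp
  | succ n ih =>
    rw [pow_succ', Module.End.mul_apply, Module.End.mul_apply, hEa, Derivation.leibniz, hc, ih,
      map_add, Derivation.map_smul, hx, hEa, smul_eq_mul, smul_eq_mul, Nat.add_sub_cancel]
    rcases n with _ | n
    · simp; ring
    · rw [Nat.add_sub_cancel, pow_succ' E n, Module.End.mul_apply, hEa]
      rw [Algebra.smul_def, Algebra.smul_def]
      push_cast
      have : vectorField P (φ i) (X i * vectorField P (φ i) ((E ^ n) f)) =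
        X i * vectorField P (φ i) (vectorField P (φ i) ((E ^ n) f)) := by
        rw [Derivation.leibniz]
        rw [vectorField_X, smul_zero, add_zero, smul_eq_mul]
      have e : (E * E ^ n) f = X i * vectorField P (φ i) ((E ^ n) f) := rfl
      rw [e, this]
      ring

/-- The derivative of `exp(λ_i X_i)` with respect to `λ_i` is `X_i exp(λ_i X_i)`. -/
lemma pderiv_rHom (i k : I) (f : MvPowerSeries I R) :
    pderiv R k (rHom P φ i f) = rHom P φ i (pderiv R k f) +
      pderiv R k (X i) * vectorField P (φ i) (rHom P φ i f) := by
  classical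
  set E : Module.End ℂ (MvPowerSeries I R) :=
    ((X i : MvPowerSeries I R) • vectorField P (φ i)).toLinearMap with hE
  have hr : ∀ f, rHom P φ i f = formalExp E f := fun _ => rfl
  have hx : ∀ (f : MvPowerSeries I R) d, coeff d (pderiv R k (X i) * f) =
      coeff 0 (pderiv R k (X i : MvPowerSeries I R)) * coeff d f := fun f d => by
    by_cases h : i = k
    · subst h; simp
    · simp [pderiv_X_of_ne h]
  ext d
  rw [map_add, hr, hr, coeff_pderiv_smul, coeff_formalExp, coeff_formalExp, hx, vectorField,
    coeff_coeffDer, coeff_formalExp, smul_sum]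
  have h1 : ∀ n ∈ range ((d + Finsupp.single k 1).degree + 1),
      ((d k : ℂ) + 1) • (n.factorial : ℂ)⁻¹ • coeff (d + Finsupp.single k 1) ((E ^ n) f) =
      (n.factorial : ℂ)⁻¹ • coeff d ((E ^ n) (pderiv R k f)) +
      ((n.factorial : ℂ)⁻¹ * n) • (coeff 0 (pderiv R k (X i : MvPowerSeries I R)) *
        coeff d (vectorField P (φ i) ((E ^ (n - 1)) f))) := fun n _ => by
    rw [smul_comm, ← coeff_pderiv_smul, pderiv_pow_smul_vectorField, map_add, smul_add, mul_smul,
      ← hx]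
    rfl
  rw [sum_congr rfl h1, sum_add_distrib, map_add, Finsupp.degree_single]
  congr 1
  · rw [sum_range_succ, hE, vectorField, coeff_pow_eq_zero _ (constantCoeff_X i) _ _ _ (by omega),
      smul_zero, add_zero]
  · rw [sum_range_succ', map_sum, mul_sum]
    simp only [CharP.cast_eq_zero, mul_zero, zero_smul, add_zero]
    refine sum_congr rfl fun n _ => ?_
    rw [Nat.factorial_succ, Nat.add_sub_cancel, Derivation.map_smul, mul_smul_comm]
    have : (((n + 1) * n.factorial : ℕ) : ℂ)⁻¹ * ((n + 1 : ℕ) : ℂ) = (n.factorial : ℂ)⁻¹ := by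
      have a1 : ((n + 1 : ℕ) : ℂ) ≠ 0 := Nat.cast_ne_zero.2 (Nat.succ_ne_zero n)
      have a2 : (n.factorial : ℂ) ≠ 0 := Nat.cast_ne_zero.2 (Nat.factorial_ne_zero n)
      rw [Nat.cast_mul]
      field_simp
    rw [this]
    rfl

variable {A : Matrix I I ℤ} (hA : IsGCM A)

lemma constantCoeff_weylSeries (i : I) (f : MvPowerSeries I R) :
    constantCoeff (weylSeries P hA φ i f) = constantCoeff f :=
  (constantCoeff_formalExp _ _).trans (constantCoeff_reflection hA i f)

lemma pderiv_weylSeries (i k : I) (f : MvPowerSeries I R) :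
    pderiv R k (weylSeries P hA φ i f) = weylSeries P hA φ i (pderiv R k f) +
      pderiv R k (X i) * (vectorField P (φ i) (weylSeries P hA φ i f) -
        ∑ j ∈ (IsGCM_column_finite hA i).toFinset,
          A j i • weylSeries P hA φ i (pderiv R j f)) := by
  change pderiv R k (rHom P φ i (reflection hA i f)) = rHom P φ i (reflection hA i _) + _ *
    (_ - ∑ j ∈ _, A j i • rHom P φ i (reflection hA i (pderiv R j f)))
  rw [pderiv_rHom, pderiv_reflection, map_sub, map_mul, map_sum]
  have : rHom P φ i (pderiv R k (X i)) = pderiv R k (X i) := by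
    by_cases h : i = k
    · subst h; simp
    · simp [pderiv_X_of_ne h]
  rw [this, mul_sub]
  simp only [map_zsmul]
  change _ + pderiv R k (X i) * vectorField P (φ i) (rHom P φ i (reflection hA i f)) = _ +
    (pderiv R k (X i) * vectorField P (φ i) (rHom P φ i (reflection hA i f)) - _)
  ring

/-- The endomorphism `s_i` of `R[[λ]]` respects the Poisson bracket with central `λ_j`. -/
lemma weylSeries_bracketSeries (i : I) (f g : MvPowerSeries I R) :
    weylSeries P hA φ i (bracketSeries P f g) =
      bracketSeries P (weylSeries P hA φ i f) (weylSeries P hA φ i g) := by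
  rw [← sub_eq_zero]
  refine eq_zero_of_pderiv (fun x : MvPowerSeries I R × MvPowerSeries I R =>
    weylSeries P hA φ i (bracketSeries P x.1 x.2) -
      bracketSeries P (weylSeries P hA φ i x.1) (weylSeries P hA φ i x.2)) ?_ ?_ (f, g)
  · rintro ⟨f, g⟩
    simp only [map_sub, constantCoeff_bracketSeries, constantCoeff_weylSeries, sub_self]
  · rintro n hn ⟨f, g⟩ k
    have hv : vectorField P (φ i) (weylSeries P hA φ i (bracketSeries P f g) -
        bracketSeries P (weylSeries P hA φ i f) (weylSeries P hA φ i g)) ∈ orderIdeal I R n :=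
      coeffDer_mem_orderIdeal _ (hn (f, g))
    convert add_mem (add_mem (hn (pderiv R k f, g)) (hn (f, pderiv R k g)))
      ((orderIdeal I R n).mul_mem_left (pderiv R k (X i)) (sub_mem hv
        (sum_mem (t := (IsGCM_column_finite hA i).toFinset) fun j _ =>
          zsmul_mem (add_mem (hn (pderiv R j f, g)) (hn (f, pderiv R j g))) (A j i)))) using 1
    simp only [map_sub, pderiv_bracketSeries, pderiv_weylSeries, vectorField_bracketSeries,
      map_add, LinearMap.add_apply]
    by_cases h : i = k
    · subst h
      simp only [pderiv_X_self, one_mul, map_sub, map_sum, map_zsmul, LinearMap.sub_apply,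
        LinearMap.sum_apply, LinearMap.smul_apply, smul_add, smul_sub,
        sum_add_distrib, sum_sub_distrib]
      ring
    · simp only [pderiv_X_of_ne h, zero_mul, map_zero, LinearMap.zero_apply]
      ring

end

section

/-! ### Monomials and their Hamiltonian derivations -/

variable {I R : Type*} [CommRing R]

/-- The group of monomials `u τ^v` with `u` a unit of `R[[λ]]` and `v` an integral exponent vector,
written as the pairs `(u, v)`. -/
abbrev UnitMonomial (I R : Type*) [CommRing R] : Type _ :=
  (MvPowerSeries I R)ˣ × Multiplicative (I →₀ ℤ)

/-- The variable `τ_k` as a monomial. -/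
def tauMonomial (k : I) : UnitMonomial I R := (1, .ofAdd (Finsupp.single k 1))

lemma hom_ext_unitMonomial {M : Type*} [Monoid M] {F G : UnitMonomial I R →* M}
    (h1 : ∀ u, F (u, 1) = G (u, 1)) (h2 : ∀ k, F (tauMonomial k) = G (tauMonomial k)) : F = G := by
  have h : F.comp (MonoidHom.inr _ _) = G.comp (MonoidHom.inr _ _) := by
    refine Finsupp.mulHom_ext' fun k => ?_
    refine MonoidHom.ext_mint ?_
    exact h2 k
  refine MonoidHom.ext fun g => ?_
  have hg : g = (g.1, 1) * (1, g.2) := by simp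
  rw [hg, map_mul, map_mul, h1]
  congr 1
  exact DFunLike.congr_fun h g.2

/-- The monomial `u τ^v` as an element of the Laurent ring. -/
def toLaurent : UnitMonomial I R →* (Laurent I R)ˣ :=
  MonoidHom.toHomUnits ((AddMonoidAlgebra.singleHom (R := MvPowerSeries I R) (M := I →₀ ℤ)).comp
    ((Units.coeHom _).prodMap (MonoidHom.id _)))

lemma toLaurent_apply (g : UnitMonomial I R) :
    (toLaurent g : Laurent I R) = AddMonoidAlgebra.single g.2.toAdd (g.1 : MvPowerSeries I R) :=
  rfl

lemma toLaurent_tauMonomial (k : I) : toLaurent (tauMonomial k : UnitMonomial I R) = tau k :=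
  Units.ext rfl

variable [Algebra ℂ R]

/-- The derivation `{log u, ·} = u⁻¹ {u, ·}`, which is additive in the logarithm of the unit `u`;
hence the multiplicative notation for the additive group of operators. -/
def logHamiltonian (P : PoissonBracket R) :
    (MvPowerSeries I R)ˣ →* Multiplicative (Module.End ℂ (MvPowerSeries I R)) where
  toFun u := .ofAdd (LinearMap.mulLeft ℂ ((u⁻¹ : (MvPowerSeries I R)ˣ) : MvPowerSeries I R) ∘ₗ
    bracketSeries P (u : MvPowerSeries I R))
  map_one' := by
    refine congrArg Multiplicative.ofAdd (LinearMap.ext fun f => ?_)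
    have h := bracketSeries_mul_left P (1 : MvPowerSeries I R) 1 f
    rw [mul_one, one_mul, left_eq_add] at h
    simp [h]
  map_mul' u v := by
    refine congrArg Multiplicative.ofAdd (LinearMap.ext fun f => ?_)
    have hu := u.inv_mul
    have hv := v.inv_mul
    change ((u * v)⁻¹ : (MvPowerSeries I R)ˣ) *
      bracketSeries P ((u * v : (MvPowerSeries I R)ˣ) : MvPowerSeries I R) f =
      (u⁻¹ : (MvPowerSeries I R)ˣ) * bracketSeries P (u : MvPowerSeries I R) f +
      (v⁻¹ : (MvPowerSeries I R)ˣ) * bracketSeries P (v : MvPowerSeries I R) f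
    rw [mul_inv, Units.val_mul, Units.val_mul, bracketSeries_mul_left]
    linear_combination (↑v⁻¹ : MvPowerSeries I R) * bracketSeries P (v : MvPowerSeries I R) f * hu +
      (↑u⁻¹ : MvPowerSeries I R) * bracketSeries P (u : MvPowerSeries I R) f * hv

/-- The partial derivative `∂/∂λ_k` as a `ℂ`-linear operator. -/
def pderivEnd (k : I) : Module.End ℂ (MvPowerSeries I R) where
  toFun := pderiv R k
  map_add' := map_add _
  map_smul' := pderiv_complex_smul k

/-- The Hamiltonian derivation `{log (u τ^v), ·} = u⁻¹ {u, ·} + ∑ k, v_k ∂/∂λ_k` of the monomial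
`u τ^v`, for the bracket on `R[[λ]][τ^{±1}]` with `{log τ_j, λ_k} = δ_jk`. -/
def hamiltonian (P : PoissonBracket R) :
    UnitMonomial I R →* Multiplicative (Module.End ℂ (MvPowerSeries I R)) :=
  (logHamiltonian P).coprod
    (AddMonoidHom.toMultiplicative (Finsupp.liftAddHom fun k =>
      (zmultiplesHom (Module.End ℂ (MvPowerSeries I R))) (pderivEnd k)))

variable (P : PoissonBracket R)

lemma hamiltonian_unit (u : (MvPowerSeries I R)ˣ) (f : MvPowerSeries I R) :
    (hamiltonian P (u, 1)).toAdd f =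
      ((u⁻¹ : (MvPowerSeries I R)ˣ) : MvPowerSeries I R) *
        bracketSeries P (u : MvPowerSeries I R) f := by
  simp [hamiltonian, logHamiltonian]

lemma hamiltonian_exponent (v : I →₀ ℤ) (f : MvPowerSeries I R) :
    (hamiltonian P (1, .ofAdd v)).toAdd f = v.sum fun k n => n • pderiv R k f := by
  simp only [hamiltonian, MonoidHom.coprod_apply, map_one, one_mul]
  change (Finsupp.liftAddHom (fun k => (zmultiplesHom (Module.End ℂ (MvPowerSeries I R)))
    (pderivEnd k)) v) f = _
  rw [Finsupp.liftAddHom_apply, Finsupp.sum, LinearMap.sum_apply]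
  rfl

lemma hamiltonian_mul (g h : UnitMonomial I R) (f : MvPowerSeries I R) :
    (hamiltonian P (g * h)).toAdd f = (hamiltonian P g).toAdd f + (hamiltonian P h).toAdd f := by
  rw [map_mul (hamiltonian P)]; rfl

lemma hamiltonian_inv (g : UnitMonomial I R) (f : MvPowerSeries I R) :
    (hamiltonian P g⁻¹).toAdd f = -(hamiltonian P g).toAdd f := by
  rw [map_inv (hamiltonian P)]; rfl

variable {A : Matrix I I ℤ} (hA : IsGCM A) (φ : I → Rˣ)

/-- The exponent `α_i = ∑ k, a_ki e_k` of the monomial `∏ k, τ_k ^ a_ki`. -/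
def simpleRoot (i : I) : I →₀ ℤ :=
  Finsupp.ofSupportFinite (fun j => A j i) (IsGCM_column_finite hA i)

lemma simpleRoot_apply (i j : I) : simpleRoot hA i j = A j i := rfl

lemma simpleRoot_support (i : I) :
    (simpleRoot hA i).support = (IsGCM_column_finite hA i).toFinset := by
  ext j; simp [simpleRoot_apply]

/-- The unit `φ_i` as a constant power series. -/
def constUnit (i : I) : (MvPowerSeries I R)ˣ :=
  Units.map (C : R →+* MvPowerSeries I R).toMonoidHom (φ i)

/-- The action of `s_i` on monomials: `u τ^v ↦ s_i(u) φ_i ^ v_i τ^(v - v_i α_i)`. -/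
def monomialAction (i : I) : Monoid.End (UnitMonomial I R) :=
  MonoidHom.mk' (fun g => (Units.map (weylSeries P hA φ i).toRingHom.toMonoidHom g.1 *
    constUnit φ i ^ (g.2.toAdd i), g.2 * .ofAdd (-(g.2.toAdd i) • simpleRoot hA i))) fun g h => by
    refine Prod.ext ?_ ?_
    · simp only [Prod.fst_mul, Prod.snd_mul, map_mul, toAdd_mul, Finsupp.add_apply, zpow_add]
      exact mul_mul_mul_comm _ _ _ _
    · simp only [Prod.snd_mul, toAdd_mul, Finsupp.add_apply, neg_add, add_smul, ofAdd_add]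
      exact mul_mul_mul_comm _ _ _ _

lemma monomialAction_apply (i : I) (g : UnitMonomial I R) :
    monomialAction P hA φ i g = (Units.map (weylSeries P hA φ i).toRingHom.toMonoidHom g.1 *
    constUnit φ i ^ (g.2.toAdd i), g.2 * .ofAdd (-(g.2.toAdd i) • simpleRoot hA i)) := rfl

/-- An endomorphism `W` of `R[[λ]][τ^{±1}]` restricts to `w` on `R[[λ]]` and to `σ` on monomials,
`w` preserves constant terms, and `w` transports the Hamiltonian derivation of each monomial `g` to
that of `σ g`. This holds for the `s_i` and is stable under composition. -/
structure IsCompatible (W : Laurent I R →ₐ[ℂ] Laurent I R)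
    (w : MvPowerSeries I R →ₐ[ℂ] MvPowerSeries I R)
    (σ : Monoid.End (UnitMonomial I R)) : Prop where
  algebraMap_apply : ∀ f, W (algebraMap _ _ f) = algebraMap _ _ (w f)
  toLaurent_apply : ∀ g, W (toLaurent g) = toLaurent (σ g)
  constantCoeff_apply : ∀ f, constantCoeff (w f) = constantCoeff f
  unit : ∀ u, σ (u, 1) = (Units.map w.toRingHom.toMonoidHom u, 1)
  hamiltonian_apply : ∀ g f, w ((hamiltonian P g).toAdd f) = (hamiltonian P (σ g)).toAdd (w f)

section

variable {P} {W W' : Laurent I R →ₐ[ℂ] Laurent I R}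
  {w w' : MvPowerSeries I R →ₐ[ℂ] MvPowerSeries I R} {σ σ' : Monoid.End (UnitMonomial I R)}

lemma IsCompatible.mul (h : IsCompatible P W w σ) (h' : IsCompatible P W' w' σ') :
    IsCompatible P (W * W') (w * w') (σ * σ') where
  algebraMap_apply f := (congrArg W (h'.1 f)).trans (h.1 _)
  toLaurent_apply f := (congrArg W (h'.2 f)).trans (h.2 _)
  constantCoeff_apply f := (h.3 _).trans (h'.3 f)
  unit u := by
    change σ (σ' (u, 1)) = _
    rw [h'.unit, h.unit]; rfl
  hamiltonian_apply g f := by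
    change w (w' _) = (hamiltonian P (σ (σ' g))).toAdd (w (w' f))
    rw [h'.hamiltonian_apply, h.hamiltonian_apply]

variable (P) in
lemma IsCompatible.one : IsCompatible P 1 1 (1 : Monoid.End (UnitMonomial I R)) where
  algebraMap_apply _ := rfl
  toLaurent_apply _ := rfl
  constantCoeff_apply _ := rfl
  unit _ := rfl
  hamiltonian_apply _ _ := rfl

lemma IsCompatible.pow (h : IsCompatible P W w σ) (n : ℕ) :
    IsCompatible P (W ^ n) (w ^ n) (σ ^ n) := by
  induction n with
  | zero => simp only [pow_zero]; exact IsCompatible.one P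
  | succ n ih => simp only [pow_succ]; exact ih.mul h

end

lemma hamiltonian_tauMonomial (k : I) (f : MvPowerSeries I R) :
    (hamiltonian P (tauMonomial k)).toAdd f = pderiv R k f := by
  rw [tauMonomial, hamiltonian_exponent, Finsupp.sum_single_index (by simp), one_smul]

section

variable {P} {W : Laurent I R →ₐ[ℂ] Laurent I R}
  {w : MvPowerSeries I R →ₐ[ℂ] MvPowerSeries I R} {σ : Monoid.End (UnitMonomial I R)}

/-- If `σ` fixes all `τ_k`, then `w` commutes with all `∂/∂λ_k` and preserves constant terms, so it
is the identity. -/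
lemma IsCompatible.series_eq_one (h : IsCompatible P W w σ)
    (hσ : ∀ k, σ (tauMonomial k) = tauMonomial k) : w = 1 := by
  refine AlgHom.ext fun f => sub_eq_zero.1 ?_
  refine eq_zero_of_pderiv (fun f => w f - f) (fun f => ?_) (fun n hn f k => ?_) f
  · rw [map_sub, h.constantCoeff_apply, sub_self]
  · convert hn (pderiv R k f) using 1
    rw [map_sub, ← hamiltonian_tauMonomial P, ← hamiltonian_tauMonomial P, h.hamiltonian_apply, hσ]

lemma IsCompatible.monomial_eq_one (h : IsCompatible P W w σ)
    (hσ : ∀ k, σ (tauMonomial k) = tauMonomial k) : σ = 1 := by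
  refine hom_ext_unitMonomial (fun u => ?_) hσ
  refine (h.unit u).trans ?_
  rw [h.series_eq_one hσ]; rfl

lemma IsCompatible.laurent_eq_one (h : IsCompatible P W w σ)
    (hσ : ∀ k, σ (tauMonomial k) = tauMonomial k) : W = 1 := by
  refine AlgHom.ext fun F => ?_
  induction F using AddMonoidAlgebra.induction_linear with
  | zero => simp
  | add F G hF hG => rw [map_add, hF, hG, map_add]
  | single v f =>
    have e : (AddMonoidAlgebra.single v f : Laurent I R) =
        algebraMap (MvPowerSeries I R) _ f * (toLaurent (1, .ofAdd v) : (Laurent I R)ˣ) := by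
      rw [PoissonWeyl.toLaurent_apply]
      change _ = AddMonoidAlgebra.single 0 f * _
      rw [AddMonoidAlgebra.single_mul_single]
      simp
    rw [e, map_mul, h.algebraMap_apply, h.toLaurent_apply, h.series_eq_one hσ,
      h.monomial_eq_one hσ]
    rfl

end

lemma hamiltonian_constUnit (i : I) (f : MvPowerSeries I R) :
    (hamiltonian P (constUnit φ i, 1)).toAdd f = vectorField P (φ i) f := by
  rw [hamiltonian_unit, vectorField_eq]; rfl

lemma monomialAction_tauMonomial_self (i : I) :
    monomialAction P hA φ i (tauMonomial i) =
      (constUnit φ i, 1) * tauMonomial i * (1, .ofAdd (simpleRoot hA i))⁻¹ := by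
  rw [monomialAction_apply]
  simp [tauMonomial]

lemma monomialAction_tauMonomial_of_ne {i k : I} (h : k ≠ i) :
    monomialAction P hA φ i (tauMonomial k) = tauMonomial k := by
  rw [monomialAction_apply]
  simp [tauMonomial, Finsupp.single_eq_of_ne (Ne.symm h)]

lemma weyl_toLaurent (i : I) (g : UnitMonomial I R) :
    weyl P hA φ i (toLaurent g) = toLaurent (monomialAction P hA φ i g) := by
  suffices h : (Units.map (weyl P hA φ i).toRingHom.toMonoidHom).comp toLaurent =
      toLaurent.comp (monomialAction P hA φ i) from
    congrArg Units.val (DFunLike.congr_fun h g)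
  refine hom_ext_unitMonomial (fun u => Units.ext ?_) fun k => Units.ext ?_
  · have h : weyl P hA φ i (algebraMap (MvPowerSeries I R) (Laurent I R) u) =
        toLaurent (monomialAction P hA φ i (u, 1)) := by
      rw [weyl_algebraMap, monomialAction_apply]
      simp [toLaurent_apply]
    exact h
  · have h : weyl P hA φ i (tau k : (Laurent I R)ˣ) =
        toLaurent (monomialAction P hA φ i (tauMonomial k)) := ?_
    · rw [MonoidHom.comp_apply, toLaurent_tauMonomial]
      exact h
    rw [weyl_tau, tauImage]
    split_ifs with h
    · subst h
      have e : (1, .ofAdd (simpleRoot hA k))⁻¹ = ∏ j ∈ (IsGCM_column_finite hA k).toFinset,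
          (tauMonomial j : UnitMonomial I R) ^ (-A j k) := by
        refine Prod.ext (by simp [tauMonomial, Prod.fst_prod]) ?_
        rw [Prod.snd_prod]
        simp only [Prod.pow_snd, tauMonomial, Prod.snd_inv, ← ofAdd_neg, ← ofAdd_zsmul,
          ← ofAdd_sum, neg_smul, sum_neg_distrib, Finsupp.smul_single, smul_eq_mul, mul_one]
        conv_lhs => rw [← Finsupp.sum_single (simpleRoot hA k), Finsupp.sum, simpleRoot_support]
        simp only [simpleRoot_apply]
      rw [monomialAction_tauMonomial_self, map_mul, map_mul, toLaurent_tauMonomial, e, map_prod]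
      simp only [map_zpow, toLaurent_tauMonomial]
      rfl
    · rw [monomialAction_tauMonomial_of_ne P hA φ h, toLaurent_tauMonomial]

/-- The endomorphism `s_i` transports Hamiltonian derivations; for `τ_i` this is the formula for
the derivative of `s_i(f)` with respect to `λ_i`. -/
lemma monomialAction_compatible (i : I) :
    IsCompatible P (weyl P hA φ i) (weylSeries P hA φ i) (monomialAction P hA φ i) where
  algebraMap_apply := weyl_algebraMap P hA φ i
  toLaurent_apply g := weyl_toLaurent P hA φ i g
  constantCoeff_apply := constantCoeff_weylSeries P φ hA i
  unit u := by
    rw [monomialAction_apply]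
    simp
  hamiltonian_apply g f := by
    let F : UnitMonomial I R →* Multiplicative (Module.End ℂ (MvPowerSeries I R)) :=
      (AddMonoidHom.toMultiplicative
        (AddMonoidHom.mulLeft ((weylSeries P hA φ i).toLinearMap :
          Module.End ℂ (MvPowerSeries I R)))).comp (hamiltonian P)
    let G : UnitMonomial I R →* Multiplicative (Module.End ℂ (MvPowerSeries I R)) :=
      (AddMonoidHom.toMultiplicative
        (AddMonoidHom.mulRight ((weylSeries P hA φ i).toLinearMap :
          Module.End ℂ (MvPowerSeries I R)))).comp
        ((hamiltonian P).comp (monomialAction P hA φ i))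
    suffices h : F = G from
      DFunLike.congr_fun (congrArg Multiplicative.toAdd (DFunLike.congr_fun h g)) f
    refine hom_ext_unitMonomial (fun u => ?_) fun k => ?_
    · refine congrArg Multiplicative.ofAdd (LinearMap.ext fun f => ?_)
      change weylSeries P hA φ i ((hamiltonian P (u, 1)).toAdd f) =
        (hamiltonian P (monomialAction P hA φ i (u, 1))).toAdd (weylSeries P hA φ i f)
      rw [hamiltonian_unit, map_mul, weylSeries_bracketSeries, monomialAction_apply]
      simp only [toAdd_one, Finsupp.coe_zero, Pi.zero_apply, zpow_zero, mul_one, neg_zero,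
        zero_smul, ofAdd_zero]
      rw [hamiltonian_unit, ← map_inv]
      rfl
    · refine congrArg Multiplicative.ofAdd (LinearMap.ext fun f => ?_)
      change weylSeries P hA φ i ((hamiltonian P (tauMonomial k)).toAdd f) =
        (hamiltonian P (monomialAction P hA φ i (tauMonomial k))).toAdd (weylSeries P hA φ i f)
      rw [hamiltonian_tauMonomial]
      by_cases h : k = i
      · subst h
        rw [monomialAction_tauMonomial_self, hamiltonian_mul, hamiltonian_mul, hamiltonian_inv,
          hamiltonian_constUnit,
          hamiltonian_tauMonomial, hamiltonian_exponent, Finsupp.sum, simpleRoot_support,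
          pderiv_weylSeries]
        simp only [simpleRoot_apply]
        have hs : ∑ j ∈ (IsGCM_column_finite hA k).toFinset,
            A j k • pderiv R j (weylSeries P hA φ k f) =
            ∑ j ∈ (IsGCM_column_finite hA k).toFinset, A j k • weylSeries P hA φ k (pderiv R j f) +
            (2 : ℤ) • (vectorField P (φ k) (weylSeries P hA φ k f) -
              ∑ j ∈ (IsGCM_column_finite hA k).toFinset,
                A j k • weylSeries P hA φ k (pderiv R j f)) := by
          simp only [pderiv_weylSeries P φ hA k _ f, smul_add, sum_add_distrib]
          congr 1
          rw [sum_eq_single k]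
          · rw [hA.diag, pderiv_X_self, one_mul]
          · intro j _ hj
            rw [pderiv_X_of_ne hj.symm, zero_mul, smul_zero]
          · intro hk
            simp [hA.diag] at hk
        rw [hs, pderiv_X_self, one_mul, two_smul]
        abel
      · rw [monomialAction_tauMonomial_of_ne P hA φ h, hamiltonian_tauMonomial,
          pderiv_weylSeries, pderiv_X_of_ne (Ne.symm h), zero_mul, add_zero]

end

/-! ### Polynomial identities of rank two -/

section RankTwo

variable {B : Type*} [CommRing B]

/-- The action of `S = s_i` and `T = s_j` on the finitely many elements that occur in the orbit of
`τ_i` when `a_ji = -1` and `a_ij = -m` with `m ≤ 3`. Here `a = λ_i`, `b = λ_j`, `x = φ_i`,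
`y = φ_j`, `z_n = ad(x)^n(y) / n!`, `w = {y, z₃}`, and `c = a / x`, `d = b / y`, so that
`S = exp(c ad(x)) r_i` and `T = exp(d ad(y)) r_j`; the Serre relations make the exponentials finite
sums. -/
structure RankTwoAction (S T : B →+* B) (m a b x y z₁ z₂ z₃ w c d : B) : Prop where
  a_eq : a = c * x
  b_eq : b = d * y
  S_a : S a = -a
  S_b : S b = b + a
  S_x : S x = x
  S_y : S y = y + c * z₁ + c ^ 2 * z₂ + c ^ 3 * z₃
  S_z₁ : S z₁ = z₁ + 2 * c * z₂ + 3 * c ^ 2 * z₃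
  S_z₂ : S z₂ = z₂ + 3 * c * z₃
  S_z₃ : S z₃ = z₃
  S_w : S w = w
  T_a : T a = a + m * b
  T_b : T b = -b
  T_x : T x = x - d * z₁
  T_y : T y = y
  T_z₁ : T z₁ = z₁
  T_z₂ : T z₂ = z₂
  T_z₃ : T z₃ = z₃ + d * w
  T_w : T w = w

/-- The coefficient from `R[[λ]]` of the monomial `s_i s_j s_i(τ_i)` for `(a_ij, a_ji) = (-3, -1)`,
in the notation of `RankTwoAction`. -/
def g2PolyThree (a b x y z₁ z₂ z₃ : B) : B :=
  -2 * a ^ 3 * z₃ - 3 * a ^ 2 * b * z₃ - a ^ 2 * x * z₂ - 2 * a * b * x * z₂ - b * x ^ 2 * z₁ +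
    x ^ 3 * y

/-- The coefficient of `s_j s_i s_j s_i(τ_i)` for `(a_ij, a_ji) = (-3, -1)`. -/
def g2PolyFour (a b x y z₁ z₂ z₃ w : B) : B :=
  -2 * a ^ 3 * b * w - 2 * a ^ 3 * y * z₃ - 15 * a ^ 2 * b ^ 2 * w - 15 * a ^ 2 * b * y * z₃ +
    a ^ 2 * b * z₁ * z₂ - a ^ 2 * x * y * z₂ - 36 * a * b ^ 3 * w - 36 * a * b ^ 2 * y * z₃ +
    4 * a * b ^ 2 * z₁ * z₂ - 4 * a * b * x * y * z₂ - 27 * b ^ 4 * w - 27 * b ^ 3 * y * z₃ +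
    3 * b ^ 3 * z₁ * z₂ - 3 * b ^ 2 * x * y * z₂ + b ^ 2 * x * z₁ ^ 2 - 2 * b * x ^ 2 * y * z₁ +
    x ^ 3 * y ^ 2

/-- The coefficient of `s_i s_j s_i s_j s_i(τ_i)` for `(a_ij, a_ji) = (-3, -1)`. -/
def g2PolyFive (a b x y z₁ z₂ z₃ w : B) : B :=
  -4 * a ^ 4 * x * w - 4 * a ^ 4 * z₁ * z₃ + a ^ 4 * z₂ ^ 2 - 28 * a ^ 3 * b * x * w -
    20 * a ^ 3 * b * z₁ * z₃ + 6 * a ^ 3 * b * z₂ ^ 2 - 8 * a ^ 3 * x * y * z₃ -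
    69 * a ^ 2 * b ^ 2 * x * w - 33 * a ^ 2 * b ^ 2 * z₁ * z₃ + 11 * a ^ 2 * b ^ 2 * z₂ ^ 2 -
    36 * a ^ 2 * b * x * y * z₃ + 2 * a ^ 2 * b * x * z₁ * z₂ - 2 * a ^ 2 * x ^ 2 * y * z₂ -
    72 * a * b ^ 3 * x * w - 18 * a * b ^ 3 * z₁ * z₃ + 6 * a * b ^ 3 * z₂ ^ 2 -
    54 * a * b ^ 2 * x * y * z₃ + 6 * a * b ^ 2 * x * z₁ * z₂ - 6 * a * b * x ^ 2 * y * z₂ -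
    27 * b ^ 4 * x * w - 27 * b ^ 3 * x * y * z₃ + 3 * b ^ 3 * x * z₁ * z₂ -
    3 * b ^ 2 * x ^ 2 * y * z₂ + b ^ 2 * x ^ 2 * z₁ ^ 2 - 2 * b * x ^ 3 * y * z₁ +
    x ^ 4 * y ^ 2

variable {S T : B →+* B} {m a b x y z₁ z₂ z₃ w c d : B}

namespace RankTwoAction

lemma T_x_mul (H : RankTwoAction S T m a b x y z₁ z₂ z₃ w c d) : T x * y = x * y - b * z₁ := by
  rw [H.T_x, H.b_eq]; ring

lemma a2_invariant (H : RankTwoAction S T 1 a b x y z₁ z₂ z₃ w c d)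
    (hz₂ : z₂ = 0) (hz₃ : z₃ = 0) :
    S (x * y - b * z₁) = x * y - b * z₁ := by
  simp only [map_sub, map_mul, H.S_b, H.S_x, H.S_y, H.S_z₁]
  rw [H.a_eq, H.b_eq, hz₂, hz₃]
  ring

lemma b2_three (H : RankTwoAction S T 2 a b x y z₁ z₂ z₃ w c d)
    (hz₃ : z₃ = 0) :
    S (x * y - b * z₁) * x = x ^ 2 * y - b * x * z₁ - a ^ 2 * z₂ - 2 * a * b * z₂ := by
  simp only [map_sub, map_mul, H.S_b, H.S_x, H.S_y, H.S_z₁]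
  rw [H.a_eq, H.b_eq, hz₃]
  ring

lemma b2_invariant (H : RankTwoAction S T 2 a b x y z₁ z₂ z₃ w c d) :
    T (x ^ 2 * y - b * x * z₁ - a ^ 2 * z₂ - 2 * a * b * z₂) =
      x ^ 2 * y - b * x * z₁ - a ^ 2 * z₂ - 2 * a * b * z₂ := by
  simp only [map_sub, map_mul, map_pow, map_ofNat, H.T_a, H.T_b, H.T_x, H.T_y, H.T_z₁, H.T_z₂]
  rw [H.a_eq, H.b_eq]
  ring

lemma g2_three (H : RankTwoAction S T 3 a b x y z₁ z₂ z₃ w c d) :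
    S (x * y - b * z₁) * x ^ 2 = g2PolyThree a b x y z₁ z₂ z₃ := by
  simp only [g2PolyThree]
  simp only [map_sub, map_mul, H.S_b, H.S_x, H.S_y, H.S_z₁]
  rw [H.a_eq, H.b_eq]
  ring

lemma g2_four (H : RankTwoAction S T 3 a b x y z₁ z₂ z₃ w c d) :
    T (g2PolyThree a b x y z₁ z₂ z₃) * y = g2PolyFour a b x y z₁ z₂ z₃ w := by
  simp only [g2PolyThree, g2PolyFour]
  simp only [map_add, map_sub, map_mul, map_neg, map_pow, map_ofNat, H.T_a, H.T_b, H.T_x, H.T_y,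
    H.T_z₁, H.T_z₂, H.T_z₃]
  rw [H.a_eq, H.b_eq]
  ring

lemma g2_five (H : RankTwoAction S T 3 a b x y z₁ z₂ z₃ w c d) :
    S (g2PolyFour a b x y z₁ z₂ z₃ w) * x = g2PolyFive a b x y z₁ z₂ z₃ w := by
  simp only [g2PolyFour, g2PolyFive]
  simp only [map_add, map_sub, map_mul, map_neg, map_pow, map_ofNat, H.S_a, H.S_b, H.S_x, H.S_y,
    H.S_z₁, H.S_z₂, H.S_z₃, H.S_w]
  rw [H.a_eq, H.b_eq]
  ring

/-- The invariance under `s_j` that closes the walk of length six. -/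
lemma g2_invariant (H : RankTwoAction S T 3 a b x y z₁ z₂ z₃ w c d) :
    T (g2PolyFive a b x y z₁ z₂ z₃ w) = g2PolyFive a b x y z₁ z₂ z₃ w := by
  simp only [g2PolyFive]
  simp only [map_add, map_sub, map_mul, map_neg, map_pow, map_ofNat, H.T_a, H.T_b, H.T_x, H.T_y,
    H.T_z₁, H.T_z₂, H.T_z₃, H.T_w]
  rw [H.a_eq, H.b_eq]
  ring

end RankTwoAction

end RankTwo

section

/-! ### The operators on constants and variables -/

variable {I R : Type*} [CommRing R]

lemma prod_tauMonomial_zpow (v : I →₀ ℤ) :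
    ∏ k ∈ v.support, (tauMonomial k : UnitMonomial I R) ^ v k = (1, .ofAdd v) := by
  refine Prod.ext (by simp [tauMonomial, Prod.fst_prod]) ?_
  rw [Prod.snd_prod]
  simp only [Prod.pow_snd, tauMonomial, ← ofAdd_zsmul, ← ofAdd_sum, Finsupp.smul_single,
    smul_eq_mul, mul_one]
  exact congrArg Multiplicative.ofAdd (Finsupp.sum_single v)

/-- The series `λ_i / φ_i`; since `{φ_i, φ_i} = 0`, it is killed by `X_i`, so
`exp(λ_i X_i) = exp((λ_i / φ_i) ad(φ_i))`. -/
def ratio (φ : I → Rˣ) (i : I) : MvPowerSeries I R := X i * C (((φ i)⁻¹ : Rˣ) : R)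

lemma ratio_mul (φ : I → Rˣ) (i : I) : ratio φ i * C (φ i : R) = X i := by
  rw [ratio, mul_assoc, ← map_mul, Units.inv_mul, map_one, mul_one]

variable [Algebra ℂ R] (P : PoissonBracket R)

/-- If the powers of the operator kill `f` from the `N`-th on, the exponential is the finite
sum. -/
lemma formalExp_eq_sum (D : Derivation ℂ R R) {t : MvPowerSeries I R} (ht : constantCoeff t = 0)
    {f : MvPowerSeries I R} {N : ℕ}
    (hN : ∀ n, N ≤ n →
      (((t • coeffDer D).toLinearMap : Module.End ℂ (MvPowerSeries I R)) ^ n) f = 0) :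
    formalExp (t • coeffDer D).toLinearMap f = ∑ n ∈ range N, (n.factorial : ℂ)⁻¹ •
      (((t • coeffDer D).toLinearMap : Module.End ℂ (MvPowerSeries I R)) ^ n) f := by
  ext d
  rw [coeff_formalExp, map_sum]
  have h1 := sum_subset (s₁ := range (d.degree + 1)) (s₂ := range (d.degree + 1 + N))
    (range_mono (Nat.le_add_right _ _)) (f := fun n => (n.factorial : ℂ)⁻¹ • coeff d
      ((((t • coeffDer D).toLinearMap : Module.End ℂ (MvPowerSeries I R)) ^ n) f))
    fun n _ hn => by
      rw [coeff_pow_eq_zero D ht f n d (by simpa using hn), smul_zero]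
  have h2 := sum_subset (s₁ := range N) (s₂ := range (d.degree + 1 + N))
    (range_mono (Nat.le_add_left _ _)) (f := fun n => (n.factorial : ℂ)⁻¹ • coeff d
      ((((t • coeffDer D).toLinearMap : Module.End ℂ (MvPowerSeries I R)) ^ n) f))
    fun n _ hn => by
      rw [hN n (by simpa using hn), map_zero, smul_zero]
  rw [h1, ← h2]
  rfl

variable {A : Matrix I I ℤ} (hA : IsGCM A) (φ : I → Rˣ)

lemma vectorField_C (u : Rˣ) (r : R) :
    vectorField P u (C r : MvPowerSeries I R) = C (((u⁻¹ : Rˣ) : R) * P.bracket u r) := by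
  classical
  ext d
  rw [vectorField, coeff_coeffDer, coeff_C, coeff_C]
  split_ifs
  · rfl
  · rw [map_zero]

lemma PoissonBracket.bracket_self (f : R) : P.bracket f f = 0 := by
  have h : (2 : ℂ) • P.bracket f f = 0 := by
    rw [two_smul]
    nth_rewrite 1 [P.skew f f]
    exact neg_add_cancel _
  exact (smul_eq_zero_iff_right two_ne_zero).1 h

lemma vectorField_ratio (i : I) : vectorField P (φ i) (ratio φ i) = 0 := by
  have h : P.bracket (φ i : R) (((φ i)⁻¹ : Rˣ) : R) = 0 := by
    rw [P.skew, bracket_inv, PoissonBracket.bracket_self, mul_zero, neg_zero, neg_zero]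
  rw [ratio, Derivation.leibniz, vectorField_X, vectorField_C, h, mul_zero, map_zero, smul_zero,
    smul_zero, add_zero]

lemma smul_vectorField_ratio_pow (i : I) (n : ℕ) (r : R) :
    ((X i : MvPowerSeries I R) • vectorField P (φ i)) (ratio φ i ^ n * C r) =
      ratio φ i ^ (n + 1) * C (P.bracket (φ i) r) := by
  rw [Derivation.smul_apply, Derivation.leibniz, Derivation.leibniz_pow, vectorField_ratio,
    vectorField_C, map_mul, smul_zero, smul_zero, smul_zero, add_zero, smul_eq_mul, smul_eq_mul,
    pow_succ]
  have e : ratio φ i = X i * C (((φ i)⁻¹ : Rˣ) : R) := rfl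
  linear_combination -(ratio φ i ^ n * C (P.bracket (φ i) r)) * e

lemma weylSeries_X (i j : I) :
    weylSeries P hA φ i (X j) = X j - A j i • X i := by
  have h : ∀ k : I, rHom P φ i (X k) = X k := fun k => by
    have hk : ∀ n, 1 ≤ n → ((((X i : MvPowerSeries I R) • vectorField P (φ i)).toLinearMap :
        Module.End ℂ (MvPowerSeries I R)) ^ n) (X k) = 0 := fun n hn => by
      obtain ⟨n, rfl⟩ := Nat.exists_eq_add_of_le' hn
      rw [pow_succ, Module.End.mul_apply]
      have : ((X i : MvPowerSeries I R) • vectorField P (φ i)).toLinearMap (X k) = 0 := by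
        change (X i : MvPowerSeries I R) * vectorField P (φ i) (X k) = 0
        rw [vectorField_X, mul_zero]
      rw [this, map_zero]
    refine (formalExp_eq_sum _ (constantCoeff_X i) hk).trans ?_
    simp
  change rHom P φ i (reflection hA i (X j)) = _
  rw [reflection_X, map_sub, map_zsmul, h, h]

lemma C_ofNat_smul (n : ℕ) [n.AtLeastTwo] (r : R) :
    (C ((OfNat.ofNat n : ℂ) • r) : MvPowerSeries I R) = OfNat.ofNat n * C r := by
  rw [Algebra.smul_def, map_mul, map_ofNat, map_ofNat]

/-- The value of `s_i` on a constant killed by `ad(φ_i)^4`, in divided powers. -/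
lemma weylSeries_C (i : I) {r₀ r₁ r₂ r₃ : R} (h0 : P.bracket (φ i) r₀ = r₁)
    (h1 : P.bracket (φ i) r₁ = (2 : ℂ) • r₂) (h2 : P.bracket (φ i) r₂ = (3 : ℂ) • r₃)
    (h3 : P.bracket (φ i) r₃ = 0) :
    weylSeries P hA φ i (C r₀) = C r₀ + ratio φ i * C r₁ + ratio φ i ^ 2 * C r₂ +
      ratio φ i ^ 3 * C r₃ := by
  set E : Module.End ℂ (MvPowerSeries I R) :=
    ((X i : MvPowerSeries I R) • vectorField P (φ i)).toLinearMap with hE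
  have step : ∀ (n : ℕ) (r : R), E (ratio φ i ^ n * C r) =
      ratio φ i ^ (n + 1) * C (P.bracket (φ i) r) := smul_vectorField_ratio_pow P φ i
  have hC : ∀ (c : ℂ) (r : R), (C (c • r) : MvPowerSeries I R) = c • C r := fun c r => by
    rw [Algebra.smul_def, map_mul, Algebra.smul_def, MvPowerSeries.algebraMap_apply]
  have e0 : (E ^ 0) (C r₀) = ratio φ i ^ 0 * C r₀ := by rw [pow_zero, pow_zero, one_mul]; rfl
  have e1 : (E ^ 1) (C r₀) = ratio φ i ^ 1 * C r₁ := by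
    rw [pow_succ', Module.End.mul_apply, e0, step, h0]
  have e2 : (E ^ 2) (C r₀) = (2 : ℂ) • (ratio φ i ^ 2 * C r₂) := by
    rw [pow_succ', Module.End.mul_apply, e1, step, h1, hC, mul_smul_comm]
  have e3 : (E ^ 3) (C r₀) = (6 : ℂ) • (ratio φ i ^ 3 * C r₃) := by
    rw [pow_succ', Module.End.mul_apply, e2, map_smul, step, h2, hC, mul_smul_comm, smul_smul]
    norm_num
  have e4 : ∀ n, 4 ≤ n → (E ^ n) (C r₀) = 0 := fun n hn => by
    obtain ⟨n, rfl⟩ := Nat.exists_eq_add_of_le' hn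
    rw [pow_add, Module.End.mul_apply, pow_succ' E 3, Module.End.mul_apply, e3, map_smul, step, h3,
      map_zero, mul_zero, smul_zero, map_zero]
  change formalExp E (reflection hA i (C r₀)) = _
  rw [reflection_C, hE, vectorField, formalExp_eq_sum _ (constantCoeff_X i) e4]
  change ∑ n ∈ range 4, (n.factorial : ℂ)⁻¹ • (E ^ n) (C r₀) = _
  simp only [sum_range_succ, range_zero, sum_empty, zero_add, e0, e1, e2, e3, smul_smul]
  norm_num [Nat.factorial]

lemma weylSeries_C_of_bracket_eq_zero (i : I) {r : R} (h : P.bracket (φ i) r = 0) :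
    weylSeries P hA φ i (C r) = C r := by
  rw [weylSeries_C P hA φ i (r₁ := 0) (r₂ := 0) (r₃ := 0) h (by simp) (by simp) (by simp)]
  simp

lemma PoissonBracket.bracket_bracket (f g h : R) :
    P.bracket f (P.bracket g h) = P.bracket (P.bracket f g) h + P.bracket g (P.bracket f h) := by
  have := P.jacobi f g h
  rw [P.skew h f, map_neg, P.skew h (P.bracket f g)] at this
  linear_combination this

/-- The Serre relations for `a_ji = -1` and `a_ij ≥ -3` give the formulas of `RankTwoAction`. The
Jacobi identity makes `w` commute with `φ_i` and `φ_j`. -/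
lemma exists_rankTwoAction {i j : I} (hji : A j i = -1)
    (hi : P.bracket (φ i) (P.bracket (φ i) (P.bracket (φ i) (P.bracket (φ i) (φ j)))) = 0)
    (hj : P.bracket (φ j) (P.bracket (φ j) (φ i)) = 0) :
    ∃ z₂ z₃ w : R,
      RankTwoAction (weylSeries P hA φ i : MvPowerSeries I R →+* MvPowerSeries I R)
        (weylSeries P hA φ j : MvPowerSeries I R →+* MvPowerSeries I R) ((-A i j : ℤ))
        (X i) (X j) (C (φ i : R)) (C (φ j : R)) (C (P.bracket (φ i) (φ j))) (C z₂) (C z₃) (C w)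
        (ratio φ i) (ratio φ j) ∧
      (P.bracket (φ i) (P.bracket (φ i) (φ j)) = 0 → z₂ = 0) ∧
      (P.bracket (φ i) (P.bracket (φ i) (P.bracket (φ i) (φ j))) = 0 → z₃ = 0) := by
  set x : R := ↑(φ i)
  set y : R := ↑(φ j)
  set z₁ := P.bracket x y with hz₁
  obtain ⟨z₂, hz₂⟩ : ∃ z₂, z₂ = (2 : ℂ)⁻¹ • P.bracket x z₁ := ⟨_, rfl⟩
  obtain ⟨z₃, hz₃⟩ : ∃ z₃, z₃ = (3 : ℂ)⁻¹ • P.bracket x z₂ := ⟨_, rfl⟩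
  obtain ⟨w, hw⟩ : ∃ w, w = P.bracket y z₃ := ⟨_, rfl⟩
  have cancel : ∀ {c : ℂ} {r : R}, c ≠ 0 → c • r = 0 → r = 0 := fun hc h =>
    (smul_eq_zero_iff_right hc).1 h
  have xz₁ : P.bracket x z₁ = (2 : ℂ) • z₂ := by rw [hz₂, smul_inv_smul₀ two_ne_zero]
  have xz₂ : P.bracket x z₂ = (3 : ℂ) • z₃ := by rw [hz₃, smul_inv_smul₀ three_ne_zero]
  have xz₃ : P.bracket x z₃ = 0 := by rw [hz₃, hz₂, map_smul, map_smul, map_smul, hi]; simp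
  have yx : P.bracket y x = -z₁ := P.skew y x
  have yz₁ : P.bracket y z₁ = 0 := by rw [yx, map_neg] at hj; exact neg_eq_zero.1 hj
  have yz₂ : P.bracket y z₂ = 0 := by
    rw [hz₂, map_smul, PoissonBracket.bracket_bracket, yx, yz₁, map_neg, LinearMap.neg_apply,
      PoissonBracket.bracket_self]
    simp
  have z₁z₂ : P.bracket z₁ z₂ = (-3 : ℂ) • w := by
    have h := PoissonBracket.bracket_bracket P y x z₂
    rw [xz₂, yx, yz₂, map_smul, ← hw, map_zero, add_zero, map_neg, LinearMap.neg_apply] at h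
    rw [neg_smul, h, neg_neg]
  have z₁z₃ : P.bracket z₁ z₃ = P.bracket x w := by
    have h := PoissonBracket.bracket_bracket P x y z₃
    rw [xz₃, map_zero, add_zero, ← hw] at h
    exact h.symm
  -- Both `{z₁, {x, z₂}} = 3 {x, w}` and `{x, {z₁, z₂}} = -3 {x, w}`, while `{{x, z₁}, z₂} = 0`.
  have xw : P.bracket x w = 0 := by
    have h := PoissonBracket.bracket_bracket P x z₁ z₂
    rw [z₁z₂, xz₁, xz₂, map_smul, map_smul, map_smul, LinearMap.smul_apply,
      PoissonBracket.bracket_self, smul_zero, zero_add, z₁z₃] at h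
    refine cancel (c := 6) (by norm_num) ?_
    rw [show (6 : ℂ) = 3 - (-3) by norm_num, sub_smul, h, sub_self]
  have yw : P.bracket y w = 0 := by
    have h := PoissonBracket.bracket_bracket P y z₁ z₂
    rw [z₁z₂, yz₁, yz₂, map_smul, map_zero, map_zero, LinearMap.zero_apply, add_zero] at h
    exact cancel (by norm_num) h
  have hXi : weylSeries P hA φ i (X i : MvPowerSeries I R) = -X i := by
    rw [weylSeries_X, hA.diag, two_smul]; ring
  have hXj : weylSeries P hA φ j (X j : MvPowerSeries I R) = -X j := by
    rw [weylSeries_X, hA.diag, two_smul]; ring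
  refine ⟨z₂, z₃, w, ⟨(ratio_mul φ i).symm, (ratio_mul φ j).symm, hXi, ?_, ?_, ?_, ?_, ?_, ?_, ?_,
    ?_, hXj, ?_, ?_, ?_, ?_, ?_, ?_⟩, ?_, ?_⟩
  · refine (weylSeries_X P hA φ i j).trans ?_
    rw [hji, neg_one_smul, sub_neg_eq_add]
  · exact weylSeries_C_of_bracket_eq_zero P hA φ i (PoissonBracket.bracket_self P _)
  · exact weylSeries_C P hA φ i rfl xz₁ xz₂ xz₃
  · refine (weylSeries_C P hA φ i (r₂ := (3 : ℂ) • z₃) (r₃ := 0) xz₁ ?_ ?_ ?_).trans ?_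
    · rw [map_smul, xz₂]
    · rw [map_smul, xz₃, smul_zero]
    · rw [map_zero]
    · rw [C_ofNat_smul, C_ofNat_smul, map_zero]; ring
  · refine (weylSeries_C P hA φ i (r₂ := 0) (r₃ := 0) xz₂ ?_ ?_ ?_).trans ?_
    · rw [map_smul, xz₃, smul_zero, smul_zero]
    · rw [map_zero, smul_zero]
    · rw [map_zero]
    · rw [C_ofNat_smul, map_zero]; ring
  · exact weylSeries_C_of_bracket_eq_zero P hA φ i xz₃
  · exact weylSeries_C_of_bracket_eq_zero P hA φ i xw
  · refine (weylSeries_X P hA φ j i).trans ?_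
    rw [zsmul_eq_mul, Int.cast_neg, neg_mul, sub_eq_add_neg]
  · refine (weylSeries_C P hA φ j (r₂ := 0) (r₃ := 0) yx ?_ ?_ ?_).trans ?_
    · rw [map_neg, smul_zero]; exact neg_eq_zero.2 yz₁
    · rw [map_zero, smul_zero]
    · rw [map_zero]
    · rw [map_neg, map_zero]; ring
  · exact weylSeries_C_of_bracket_eq_zero P hA φ j (PoissonBracket.bracket_self P _)
  · exact weylSeries_C_of_bracket_eq_zero P hA φ j yz₁
  · exact weylSeries_C_of_bracket_eq_zero P hA φ j yz₂
  · refine (weylSeries_C P hA φ j (r₂ := 0) (r₃ := 0) hw.symm ?_ ?_ ?_).trans ?_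
    · rw [smul_zero]; exact yw
    · rw [map_zero, smul_zero]
    · rw [map_zero]
    · rw [map_zero]; ring
  · exact weylSeries_C_of_bracket_eq_zero P hA φ j yw
  · intro h; rw [hz₂, h, smul_zero]
  · intro h; rw [hz₃, hz₂, map_smul, h, smul_zero, smul_zero]

end

/-! ### Braid relations on monomials -/

section

variable {I R : Type*} [CommRing R] {A : Matrix I I ℤ} (hA : IsGCM A)

/-- The monomial `g` is `p τ_i / (α_i^c α_j^d)`, where `α_k` stands for the monomial
`∏ l, τ_l ^ a_lk`; all monomials in the orbit of `τ_i` under `s_i` and `s_j` have this form. -/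
structure IsWalk (i j : I) (g : UnitMonomial I R) (p : MvPowerSeries I R) (c d : ℤ) : Prop where
  series : (g.1 : MvPowerSeries I R) = p
  exponent : g.2.toAdd = Finsupp.single i 1 - c • simpleRoot hA i - d • simpleRoot hA j

variable {hA} {i j : I} {g g' : UnitMonomial I R} {p : MvPowerSeries I R} {c d : ℤ}

lemma IsWalk.ext (h : IsWalk hA i j g p c d) (h' : IsWalk hA i j g' p c d) : g = g' :=
  Prod.ext (Units.ext (h.series.trans h'.series.symm))
    (Multiplicative.toAdd.injective (h.exponent.trans h'.exponent.symm))

lemma IsWalk.start : IsWalk hA i j (tauMonomial i : UnitMonomial I R) 1 0 0 :=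
  ⟨rfl, by simp [tauMonomial]⟩

end

section

variable {I R : Type*} [CommRing R] [Algebra ℂ R] (P : PoissonBracket R)
variable {A : Matrix I I ℤ} (hA : IsGCM A) (φ : I → Rˣ)

/-- On `τ_i` this rests on `s_i(φ_i) = φ_i`. -/
lemma monomialAction_sq (i : I) : monomialAction P hA φ i * monomialAction P hA φ i = 1 := by
  refine ((monomialAction_compatible P hA φ i).mul
    (monomialAction_compatible P hA φ i)).monomial_eq_one fun k => ?_
  change monomialAction P hA φ i (monomialAction P hA φ i (tauMonomial k)) = _
  by_cases h : k = i
  · subst h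
    have hφ : monomialAction P hA φ k (constUnit φ k, 1) = (constUnit φ k, 1) := by
      rw [monomialAction_apply]
      refine Prod.ext (Units.ext ?_) (by simp)
      have h := weylSeries_C_of_bracket_eq_zero P hA φ k (PoissonBracket.bracket_self P (φ k : R))
      simp only [toAdd_one, Finsupp.coe_zero, Pi.zero_apply, zpow_zero, mul_one]
      exact h
    have hα : monomialAction P hA φ k (1, .ofAdd (simpleRoot hA k)) =
        (constUnit φ k, 1) * (constUnit φ k, 1) * (1, .ofAdd (simpleRoot hA k))⁻¹ := by
      rw [monomialAction_apply]
      refine Prod.ext ?_ ?_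
      · simp [simpleRoot_apply, hA.diag, sq]
      · simp only [toAdd_ofAdd, simpleRoot_apply, hA.diag, ← ofAdd_add, Prod.snd_mul, Prod.snd_inv,
          ← ofAdd_neg, one_mul]
        congr 1
        rw [neg_smul, two_smul]; abel
    rw [monomialAction_tauMonomial_self, map_mul, map_mul, map_inv, hφ, hα,
      monomialAction_tauMonomial_self]
    simp only [mul_inv, inv_inv]
    generalize ((constUnit φ k, 1) : UnitMonomial I R) = u
    generalize (((1, .ofAdd (simpleRoot hA k))) : UnitMonomial I R) = v
    rw [show u * (u * tauMonomial k * v⁻¹) * (u⁻¹ * u⁻¹ * v) =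
      (u * u⁻¹) * (u * u⁻¹) * (v⁻¹ * v) * tauMonomial k by
        simp only [mul_comm, mul_left_comm, mul_assoc]]
    simp
  · rw [monomialAction_tauMonomial_of_ne P hA φ h, monomialAction_tauMonomial_of_ne P hA φ h]

section Walk

variable {hA} {i j : I} {g g' : UnitMonomial I R} {p : MvPowerSeries I R} {c d : ℤ}

lemma IsWalk.left (h : IsWalk hA i j g p c d) (n : ℕ) (hn : (n : ℤ) = 1 - 2 * c - A i j * d)
    {p' : MvPowerSeries I R} (hp : weylSeries P hA φ i p * C (φ i : R) ^ n = p') :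
    IsWalk hA i j (monomialAction P hA φ i g) p' (c + n) d := by
  have hg : g.2.toAdd i = n := by
    rw [h.exponent, hn]
    simp only [Finsupp.sub_apply, Finsupp.single_eq_same, Finsupp.smul_apply, simpleRoot_apply,
      hA.diag, smul_eq_mul]
    ring
  rw [monomialAction_apply, hg]
  refine ⟨?_, ?_⟩
  · rw [← hp, ← h.series, zpow_natCast]; rfl
  · simp only [toAdd_mul, toAdd_ofAdd, h.exponent, add_smul, neg_smul]
    abel

lemma IsWalk.right (hij : i ≠ j) (h : IsWalk hA i j g p c d) (n : ℕ)
    (hn : (n : ℤ) = -(A j i * c) - 2 * d) {p' : MvPowerSeries I R}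
    (hp : weylSeries P hA φ j p * C (φ j : R) ^ n = p') :
    IsWalk hA i j (monomialAction P hA φ j g) p' c (d + n) := by
  have hg : g.2.toAdd j = n := by
    rw [h.exponent, hn]
    simp only [Finsupp.sub_apply, Finsupp.single_eq_of_ne hij.symm, Finsupp.smul_apply,
      simpleRoot_apply, hA.diag, smul_eq_mul]
    ring
  rw [monomialAction_apply, hg]
  refine ⟨?_, ?_⟩
  · rw [← hp, ← h.series, zpow_natCast]; rfl
  · simp only [toAdd_mul, toAdd_ofAdd, h.exponent, add_smul, neg_smul]
    abel

lemma IsWalk.first :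
    IsWalk hA i j (monomialAction P hA φ i (tauMonomial i)) (C (φ i : R)) 1 0 :=
  IsWalk.start.left P φ 1 (by simp) (by simp)

end Walk

variable {φ}

/-- The two alternating words of length `m_ij` in `s_i` and `s_j` agree on `τ_i`; here
`m_ij = 2`. -/
lemma braid_tauMonomial_two (hφ : SerreRelations P A φ) {i j : I} (hij : i ≠ j)
    (h2 : A j i = 0) :
    (monomialAction P hA φ i * monomialAction P hA φ j) (tauMonomial i) =
      (monomialAction P hA φ j * monomialAction P hA φ i) (tauMonomial i) := by
  have hb : P.bracket (φ j) (φ i) = 0 := by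
    have := hφ j i hij.symm; rw [h2] at this; exact this
  have w1 : IsWalk hA i j _ _ 1 0 := IsWalk.first P φ
  have w2 := w1.right P φ hij 0 (by simp [h2])
    (by rw [weylSeries_C_of_bracket_eq_zero P hA φ j hb, pow_zero, mul_one])
  change monomialAction P hA φ i (monomialAction P hA φ j (tauMonomial i)) = _
  rw [monomialAction_tauMonomial_of_ne P hA φ hij]
  exact (w2.ext w1).symm

/-- The case `m_ij = 3` of the braid relation on `τ_i`. -/
lemma braid_tauMonomial_three (hφ : SerreRelations P A φ) {i j : I} (hij : i ≠ j)
    (h1 : A i j = -1) (h2 : A j i = -1) :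
    (monomialAction P hA φ i * monomialAction P hA φ j * monomialAction P hA φ i) (tauMonomial i) =
      (monomialAction P hA φ j * monomialAction P hA φ i * monomialAction P hA φ j)
        (tauMonomial i) := by
  have hi : P.bracket (φ i) (P.bracket (φ i) (φ j)) = 0 := by
    have := hφ i j hij; rw [h1] at this; exact this
  have hj : P.bracket (φ j) (P.bracket (φ j) (φ i)) = 0 := by
    have := hφ j i hij.symm; rw [h2] at this; exact this
  obtain ⟨z₂, z₃, w, H, hz₂, hz₃⟩ := exists_rankTwoAction P hA φ h2 (by rw [hi]; simp) hj
  rw [h1, neg_neg, Int.cast_one] at H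
  have w1 : IsWalk hA i j _ _ 1 0 := IsWalk.first P φ
  have w2 := w1.right P φ hij 1 (by simp [h2]) ((congrArg _ (pow_one _)).trans H.T_x_mul)
  have w3 := w2.left P φ 0 (by simp [h1]) ((congrArg _ (pow_zero _)).trans ((mul_one _).trans
    (H.a2_invariant (by rw [hz₂ hi, map_zero]) (by rw [hz₃ (by rw [hi, map_zero]), map_zero]))))
  change _ = monomialAction P hA φ j (monomialAction P hA φ i (monomialAction P hA φ j
    (tauMonomial i)))
  rw [monomialAction_tauMonomial_of_ne P hA φ hij]
  exact w3.ext w2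

/-- The case `m_ij = 4` of the braid relation on `τ_i`. -/
lemma braid_tauMonomial_four (hφ : SerreRelations P A φ) {i j : I} (hij : i ≠ j)
    (h1 : A i j = -2) (h2 : A j i = -1) :
    ((monomialAction P hA φ i * monomialAction P hA φ j) ^ 2) (tauMonomial i) =
      ((monomialAction P hA φ j * monomialAction P hA φ i) ^ 2) (tauMonomial i) := by
  have hi : P.bracket (φ i) (P.bracket (φ i) (P.bracket (φ i) (φ j))) = 0 := by
    have := hφ i j hij; rw [h1] at this; exact this
  have hj : P.bracket (φ j) (P.bracket (φ j) (φ i)) = 0 := by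
    have := hφ j i hij.symm; rw [h2] at this; exact this
  obtain ⟨z₂, z₃, w, H, hz₂, hz₃⟩ := exists_rankTwoAction P hA φ h2 (by rw [hi]; simp) hj
  rw [h1, neg_neg, Int.cast_ofNat] at H
  have w1 : IsWalk hA i j _ _ 1 0 := IsWalk.first P φ
  have w2 := w1.right P φ hij 1 (by simp [h2]) ((congrArg _ (pow_one _)).trans H.T_x_mul)
  have w3 := w2.left P φ 1 (by simp [h1]) ((congrArg _ (pow_one _)).trans
    (H.b2_three (by rw [hz₃ hi, map_zero])))
  have w4 := w3.right P φ hij 0 (by simp [h2]) ((congrArg _ (pow_zero _)).trans ((mul_one _).trans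
    H.b2_invariant))
  rw [sq, sq]
  change monomialAction P hA φ i (monomialAction P hA φ j (monomialAction P hA φ i
    (monomialAction P hA φ j (tauMonomial i)))) = _
  rw [monomialAction_tauMonomial_of_ne P hA φ hij]
  exact (w4.ext w3).symm

/-- The case `m_ij = 6` of the braid relation on `τ_i`. -/
lemma braid_tauMonomial_six (hφ : SerreRelations P A φ) {i j : I} (hij : i ≠ j)
    (h1 : A i j = -3) (h2 : A j i = -1) :
    ((monomialAction P hA φ i * monomialAction P hA φ j) ^ 3) (tauMonomial i) =
      ((monomialAction P hA φ j * monomialAction P hA φ i) ^ 3) (tauMonomial i) := by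
  have hi : P.bracket (φ i) (P.bracket (φ i) (P.bracket (φ i) (P.bracket (φ i) (φ j)))) = 0 := by
    have := hφ i j hij; rw [h1] at this; exact this
  have hj : P.bracket (φ j) (P.bracket (φ j) (φ i)) = 0 := by
    have := hφ j i hij.symm; rw [h2] at this; exact this
  obtain ⟨z₂, z₃, w, H, hz₂, hz₃⟩ := exists_rankTwoAction P hA φ h2 hi hj
  rw [h1, neg_neg, Int.cast_ofNat] at H
  have w1 : IsWalk hA i j _ _ 1 0 := IsWalk.first P φ
  have w2 := w1.right P φ hij 1 (by simp [h2]) ((congrArg _ (pow_one _)).trans H.T_x_mul)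
  have w3 := w2.left P φ 2 (by simp [h1]) H.g2_three
  have w4 := w3.right P φ hij 1 (by simp [h2]) ((congrArg _ (pow_one _)).trans H.g2_four)
  have w5 := w4.left P φ 1 (by simp [h1]) ((congrArg _ (pow_one _)).trans H.g2_five)
  have w6 := w5.right P φ hij 0 (by simp [h2]) ((congrArg _ (pow_zero _)).trans ((mul_one _).trans
    H.g2_invariant))
  rw [pow_three, pow_three]
  change monomialAction P hA φ i (monomialAction P hA φ j (monomialAction P hA φ i
    (monomialAction P hA φ j (monomialAction P hA φ i (monomialAction P hA φ j
    (tauMonomial i)))))) = _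
  rw [monomialAction_tauMonomial_of_ne P hA φ hij]
  exact (w6.ext w5).symm

variable {P} in
/-- If a compatible `σ` fixes `τ_k` for `k ≠ j` and `φ_i τ_j`, then it fixes `τ_j`. Indeed `w`
commutes with `∂_k` for `k ≠ j` and with `∂_j + X_i`; all of these kill `φ_i`, so they kill
`w(φ_i) - φ_i`, which has no constant term and thus vanishes. -/
lemma IsCompatible.tauMonomial_fixed {W : Laurent I R →ₐ[ℂ] Laurent I R}
    {w : MvPowerSeries I R →ₐ[ℂ] MvPowerSeries I R} {σ : Monoid.End (UnitMonomial I R)}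
    (h : IsCompatible P W w σ) {i j : I} (h1 : ∀ k, k ≠ j → σ (tauMonomial k) = tauMonomial k)
    (h2 : σ ((constUnit φ i, 1) * tauMonomial j) = (constUnit φ i, 1) * tauMonomial j) :
    σ (tauMonomial j) = tauMonomial j := by
  have hw : w (C (φ i : R)) = C (φ i : R) := by
    -- `∂_j + X_i` is the Hamiltonian derivation of the fixed monomial `φ_i τ_j`
    have hX : ∀ f, pderiv R j (w f) + vectorField P (φ i) (w f) =
        w (pderiv R j f + vectorField P (φ i) f) := fun f => by
      rw [add_comm, add_comm (pderiv R j f)]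
      have := h.hamiltonian_apply ((constUnit φ i, 1) * tauMonomial j) f
      rw [h2] at this
      simpa only [hamiltonian_mul, hamiltonian_constUnit, hamiltonian_tauMonomial] using this.symm
    have hC : vectorField P (φ i) (C (φ i : R) : MvPowerSeries I R) = 0 := by
      rw [vectorField_C, PoissonBracket.bracket_self, mul_zero, map_zero]
    rw [← sub_eq_zero]
    refine eq_zero_of_pderiv (fun _ : Unit => w (C (φ i : R)) - C (φ i : R))
      (fun _ => by rw [map_sub, h.constantCoeff_apply, sub_self]) (fun n hn _ k => ?_) ()
    by_cases hk : k = j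
    · subst hk
      have := hX (C (φ i : R))
      rw [hC, pderiv_C, add_zero, map_zero, add_eq_zero_iff_eq_neg] at this
      rw [map_sub, pderiv_C, sub_zero, this]
      have h3 := coeffDer_mem_orderIdeal (((φ i)⁻¹ : Rˣ).1 • ad P (φ i)) (hn ())
      rw [map_sub] at h3
      change vectorField P (φ i) (w (C (φ i : R))) - vectorField P (φ i) (C (φ i : R)) ∈ _ at h3
      rw [hC, sub_zero] at h3
      exact neg_mem h3
    · have := h.hamiltonian_apply (tauMonomial k) (C (φ i : R))
      rw [h1 k hk, hamiltonian_tauMonomial, hamiltonian_tauMonomial, pderiv_C, map_zero] at this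
      rw [map_sub, ← this, pderiv_C, sub_zero]
      exact zero_mem _
  have hu : σ (constUnit φ i, 1) = (constUnit φ i, 1) := by
    refine (h.unit _).trans (Prod.ext (Units.ext hw) rfl)
  rw [map_mul, hu] at h2
  exact mul_left_cancel h2

/-- When `a_ji = -1`, the relation `(s_i s_j)^m = 1` on monomials needs to be checked on `τ_i` only
(in both orders). The remaining `τ_j` occurs in `s_i(τ_i)` with exponent `1`, so that `φ_i τ_j` is
fixed, and `IsCompatible.tauMonomial_fixed` applies. -/
lemma tauMonomial_fixed_of_braid {i j : I} (hji : A j i = -1) (hij : i ≠ j) (m : ℕ)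
    (h1 : ((monomialAction P hA φ i * monomialAction P hA φ j) ^ m) (tauMonomial i) = tauMonomial i)
    (h2 : ((monomialAction P hA φ j * monomialAction P hA φ i) ^ m) (tauMonomial i) = tauMonomial i)
    (k : I) :
    ((monomialAction P hA φ i * monomialAction P hA φ j) ^ m) (tauMonomial k) = tauMonomial k := by
  set s := monomialAction P hA φ i with hs
  set t := monomialAction P hA φ j with ht
  have hρ : IsCompatible P ((weyl P hA φ i * weyl P hA φ j) ^ m)
      ((weylSeries P hA φ i * weylSeries P hA φ j) ^ m) ((s * t) ^ m) :=
    ((monomialAction_compatible P hA φ i).mul (monomialAction_compatible P hA φ j)).pow m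
  have hne : ∀ k, k ≠ j → ((s * t) ^ m) (tauMonomial k) = tauMonomial k := fun k hk => by
    by_cases hki : k = i
    · rw [hki, h1]
    · have hst : (s * t) (tauMonomial k) = tauMonomial k := by
        change s (t (tauMonomial k)) = _
        rw [ht, monomialAction_tauMonomial_of_ne P hA φ hk, hs,
          monomialAction_tauMonomial_of_ne P hA φ hki]
      clear h1 h2 hρ
      induction m with
      | zero => rfl
      | succ m ih =>
        rw [pow_succ]
        exact (congrArg _ hst).trans ih
  by_cases hk : k = j
  swap
  · exact hne k hk
  subst hk
  refine hρ.tauMonomial_fixed (φ := φ) (i := i) hne ?_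
  have hsi : ((s * t) ^ m) (s (tauMonomial i)) = s (tauMonomial i) := by
    have : (s * t) ^ m * s = s * (t * s) ^ m := (mul_pow_mul s t m)
    refine (DFunLike.congr_fun this (tauMonomial i)).trans ?_
    exact congrArg s h2
  have hroot : ((s * t) ^ m) (1, .ofAdd (simpleRoot hA i + Finsupp.single k 1)) =
      (1, .ofAdd (simpleRoot hA i + Finsupp.single k 1)) := by
    rw [← prod_tauMonomial_zpow, map_prod]
    refine prod_congr rfl fun l hl => ?_
    rw [map_zpow, hne]
    rintro rfl
    simp [simpleRoot_apply, hji] at hl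
  -- `φ_i τ_j` is `s_i(τ_i) τ_i⁻¹ τ^(α_i + e_j)`, where `α_i + e_j` does not involve `e_j`.
  have e : ((constUnit φ i, 1) : UnitMonomial I R) * tauMonomial k = s (tauMonomial i) *
      (tauMonomial i)⁻¹ * (1, .ofAdd (simpleRoot hA i + Finsupp.single k 1)) := by
    rw [hs, monomialAction_tauMonomial_self, tauMonomial, tauMonomial]
    refine Prod.ext (by simp) ?_
    simp only [Prod.snd_mul, Prod.snd_inv, ← ofAdd_neg, ← ofAdd_add, one_mul]
    congr 1
    abel
  rw [e, map_mul, map_mul, map_inv, hsi, hne i hij, hroot]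

end

/-! ### Words in two involutions -/

section Words

variable {M : Type*} [Monoid M] {s t : M}

lemma mul_pow_mul_mul_pow_cancel (hs : s * s = 1) (ht : t * t = 1) (n : ℕ) :
    (s * t) ^ n * (t * s) ^ n = 1 := by
  have h : s * t * (t * s) = 1 := by rw [mul_assoc, ← mul_assoc t, ht, one_mul, hs]
  induction n with
  | zero => rw [pow_zero, pow_zero, one_mul]
  | succ n ih => rw [pow_succ, pow_succ', mul_assoc, ← mul_assoc (s * t), h, one_mul, ih]

lemma mul_pow_eq_one_swap (hs : s * s = 1) {m : ℕ} (h : (t * s) ^ m = 1) : (s * t) ^ m = 1 := by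
  have e : (s * t) ^ m * s = s := by rw [mul_pow_mul, h, mul_one]
  rw [← mul_one ((s * t) ^ m), ← hs, ← mul_assoc, e]

lemma mul_pow_eq_of_pow_eq_one (hs : s * s = 1) (ht : t * t = 1) {n m : ℕ}
    (hm : m = n + n) (h : (s * t) ^ m = 1) : (s * t) ^ n = (t * s) ^ n := by
  subst hm
  rw [← mul_one ((s * t) ^ n), ← mul_pow_mul_mul_pow_cancel hs ht n, ← mul_assoc, ← pow_add, h,
    one_mul]

lemma mul_mul_eq_of_pow_three_eq_one (hs : s * s = 1) (ht : t * t = 1)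
    (h : (s * t) ^ 3 = 1) : s * t * s = t * s * t := by
  have e : s * t * s * (t * s * t) = 1 := by rw [← h, pow_three]; simp only [mul_assoc]
  have e' : t * s * t * (t * s * t) = 1 := by
    simp only [mul_assoc]
    rw [← mul_assoc t t, ht, one_mul, ← mul_assoc s s, hs, one_mul, ht]
  rw [← mul_one (s * t * s), ← e', ← mul_assoc, e, one_mul]

end Words

section Fixed

variable {M : Type*} [Monoid M] {s t : Monoid.End M} {e : M}

lemma pow_apply_eq_self_of_even (hs : s * s = 1) (ht : t * t = 1) {n m : ℕ} (hm : m = n + n)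
    (h : ((s * t) ^ n) e = ((t * s) ^ n) e) : ((s * t) ^ m) e = e := by
  rw [hm, pow_add]
  change ((s * t) ^ n) (((s * t) ^ n) e) = e
  rw [h]
  exact DFunLike.congr_fun (mul_pow_mul_mul_pow_cancel hs ht n) e

lemma pow_three_apply_eq_self (hs : s * s = 1) (ht : t * t = 1)
    (h : (s * t * s) e = (t * s * t) e) : ((s * t) ^ 3) e = e := by
  have e1 : (s * t) ^ 3 = s * t * s * (t * s * t) := by rw [pow_three]; simp only [mul_assoc]
  have e2 : s * t * s * (s * t * s) = 1 := by
    simp only [mul_assoc]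
    rw [← mul_assoc s s, hs, one_mul, ← mul_assoc t t, ht, one_mul, hs]
  rw [e1]
  change (s * t * s) ((t * s * t) e) = e
  rw [← h]
  exact DFunLike.congr_fun e2 e

end Fixed

/-! ### The relations of the Weyl group -/

section

variable {I R : Type*} [CommRing R] [Algebra ℂ R] (P : PoissonBracket R)
variable {A : Matrix I I ℤ} (hA : IsGCM A) {φ : I → Rˣ}

lemma eq_neg_one_of_mul_eq {p q : ℤ} (hp : p ≤ 0) (hq : q ≤ 0) {n : ℕ} (hn : n.Prime)
    (h : p * q = n) : (p = -n ∧ q = -1) ∨ (q = -n ∧ p = -1) := by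
  lift -p to ℕ using by omega with p' hp'
  lift -q to ℕ using by omega with q' hq'
  obtain rfl : p = -p' := by omega
  obtain rfl : q = -q' := by omega
  have h' : p' * q' = n := by exact_mod_cast (neg_mul_neg _ _).symm.trans h
  rcases (Nat.prime_mul_iff.1 (h' ▸ hn)) with ⟨_, h1⟩ | ⟨_, h1⟩
  · subst h1; left; simp [← h']
  · subst h1; right; simp [← h']

lemma coxeterExponent_cases {A : Matrix I I ℤ} (hA : IsGCM A) (i j : I) (hij : i ≠ j) {m : ℕ}
    (hm : coxeterExponent (A i j * A j i) = m) :
    (m = 2 ∧ A i j = 0 ∧ A j i = 0) ∨ (m = 3 ∧ A i j = -1 ∧ A j i = -1) ∨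
      (m = 4 ∧ A i j = -2 ∧ A j i = -1) ∨ (m = 4 ∧ A j i = -2 ∧ A i j = -1) ∨
      (m = 6 ∧ A i j = -3 ∧ A j i = -1) ∨ (m = 6 ∧ A j i = -3 ∧ A i j = -1) := by
  have hp := hA.nonpos i j hij
  have hq := hA.nonpos j i hij.symm
  unfold coxeterExponent at hm
  split_ifs at hm with h0 h1 h2 h3
  · have : m = 2 := by exact_mod_cast hm.symm
    rcases mul_eq_zero.1 h0 with h | h
    · exact .inl ⟨this, h, (hA.zero_iff i j).1 h⟩
    · exact .inl ⟨this, (hA.zero_iff j i).1 h, h⟩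
  · have : m = 3 := by exact_mod_cast hm.symm
    rcases Int.mul_eq_one_iff_eq_one_or_neg_one.1 h1 with h | h <;> omega
  · have : m = 4 := by exact_mod_cast hm.symm
    rcases eq_neg_one_of_mul_eq hp hq Nat.prime_two (by exact_mod_cast h2) with h | h <;>
      push_cast at h <;> omega
  · have : m = 6 := by exact_mod_cast hm.symm
    rcases eq_neg_one_of_mul_eq hp hq Nat.prime_three (by exact_mod_cast h3) with h | h <;>
      push_cast at h <;> omega
  · exact absurd hm (ENat.top_ne_natCast m)

lemma monomialAction_pow_eq_one_of_braid {i j : I} (hji : A j i = -1) (hij : i ≠ j) (m : ℕ)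
    (h1 : ((monomialAction P hA φ i * monomialAction P hA φ j) ^ m) (tauMonomial i) = tauMonomial i)
    (h2 : ((monomialAction P hA φ j * monomialAction P hA φ i) ^ m) (tauMonomial i) =
      tauMonomial i) :
    (monomialAction P hA φ i * monomialAction P hA φ j) ^ m = 1 :=
  (((monomialAction_compatible P hA φ i).mul
    (monomialAction_compatible P hA φ j)).pow m).monomial_eq_one
      (tauMonomial_fixed_of_braid P hA hji hij m h1 h2)

lemma monomialAction_mul_pow (hφ : SerreRelations P A φ) {i j : I} (hij : i ≠ j) {m : ℕ}
    (hm : coxeterExponent (A i j * A j i) = m) :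
    (monomialAction P hA φ i * monomialAction P hA φ j) ^ m = 1 := by
  have four : ∀ {i j : I}, i ≠ j → A i j = -2 → A j i = -1 →
      (monomialAction P hA φ i * monomialAction P hA φ j) ^ 4 = 1 := fun {i j} hij h1 h2 => by
    have hi := monomialAction_sq P hA φ i
    have hj := monomialAction_sq P hA φ j
    have h := braid_tauMonomial_four P hA hφ hij h1 h2
    exact monomialAction_pow_eq_one_of_braid P hA h2 hij 4
      (pow_apply_eq_self_of_even hi hj rfl h) (pow_apply_eq_self_of_even hj hi rfl h.symm)
  have six : ∀ {i j : I}, i ≠ j → A i j = -3 → A j i = -1 →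
      (monomialAction P hA φ i * monomialAction P hA φ j) ^ 6 = 1 := fun {i j} hij h1 h2 => by
    have hi := monomialAction_sq P hA φ i
    have hj := monomialAction_sq P hA φ j
    have h := braid_tauMonomial_six P hA hφ hij h1 h2
    exact monomialAction_pow_eq_one_of_braid P hA h2 hij 6
      (pow_apply_eq_self_of_even hi hj rfl h) (pow_apply_eq_self_of_even hj hi rfl h.symm)
  have hi := monomialAction_sq P hA φ i
  have hj := monomialAction_sq P hA φ j
  rcases coxeterExponent_cases hA i j hij hm with ⟨rfl, h1, h2⟩ | ⟨rfl, h1, h2⟩ | ⟨rfl, h1, h2⟩ |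
    ⟨rfl, h1, h2⟩ | ⟨rfl, h1, h2⟩ | ⟨rfl, h1, h2⟩
  · refine (((monomialAction_compatible P hA φ i).mul
      (monomialAction_compatible P hA φ j)).pow 2).monomial_eq_one fun k => ?_
    by_cases hki : k = i
    · subst hki
      refine pow_apply_eq_self_of_even hi hj (n := 1) rfl ?_
      rw [pow_one, pow_one]
      exact braid_tauMonomial_two P hA hφ hij h2
    by_cases hkj : k = j
    · subst hkj
      refine pow_apply_eq_self_of_even hi hj (n := 1) rfl ?_
      rw [pow_one, pow_one]
      exact (braid_tauMonomial_two P hA hφ hij.symm h1).symm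
    have h : (monomialAction P hA φ i * monomialAction P hA φ j) (tauMonomial k) = tauMonomial k :=
      (congrArg _ (monomialAction_tauMonomial_of_ne P hA φ hkj)).trans
        (monomialAction_tauMonomial_of_ne P hA φ hki)
    rw [sq]
    exact (congrArg _ h).trans h
  · have h := braid_tauMonomial_three P hA hφ hij h1 h2
    exact monomialAction_pow_eq_one_of_braid P hA h2 hij 3
      (pow_three_apply_eq_self hi hj h) (pow_three_apply_eq_self hj hi h.symm)
  · exact four hij h1 h2
  · exact mul_pow_eq_one_swap hi (four hij.symm h1 h2)
  · exact six hij h1 h2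
  · exact mul_pow_eq_one_swap hi (six hij.symm h1 h2)

variable (φ) in
lemma weyl_mul_self (i : I) : weyl P hA φ i * weyl P hA φ i = 1 :=
  ((monomialAction_compatible P hA φ i).mul (monomialAction_compatible P hA φ i)).laurent_eq_one
    fun k => DFunLike.congr_fun (monomialAction_sq P hA φ i) (tauMonomial k)

variable (φ) in
lemma weylSeries_mul_self (i : I) : weylSeries P hA φ i * weylSeries P hA φ i = 1 :=
  ((monomialAction_compatible P hA φ i).mul (monomialAction_compatible P hA φ i)).series_eq_one
    fun k => DFunLike.congr_fun (monomialAction_sq P hA φ i) (tauMonomial k)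

lemma weyl_mul_pow (hφ : SerreRelations P A φ) {i j : I} (hij : i ≠ j) {m : ℕ}
    (hm : coxeterExponent (A i j * A j i) = m) : (weyl P hA φ i * weyl P hA φ j) ^ m = 1 :=
  (((monomialAction_compatible P hA φ i).mul
    (monomialAction_compatible P hA φ j)).pow m).laurent_eq_one
      fun k => DFunLike.congr_fun (monomialAction_mul_pow P hA hφ hij hm) (tauMonomial k)

lemma weylSeries_mul_pow (hφ : SerreRelations P A φ) {i j : I} (hij : i ≠ j) {m : ℕ}
    (hm : coxeterExponent (A i j * A j i) = m) :
    (weylSeries P hA φ i * weylSeries P hA φ j) ^ m = 1 :=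
  (((monomialAction_compatible P hA φ i).mul
    (monomialAction_compatible P hA φ j)).pow m).series_eq_one
      fun k => DFunLike.congr_fun (monomialAction_mul_pow P hA hφ hij hm) (tauMonomial k)

/-! ### The reflections as operators of the zero bracket -/

section Reflection

variable (R) in
/-- The zero Poisson bracket. -/
def zeroBracket : PoissonBracket R where
  bracket := 0
  skew _ _ := neg_zero.symm
  leibniz _ _ _ := by simp
  jacobi _ _ _ := by simp

lemma serreRelations_zeroBracket {A : Matrix I I ℤ} (hA : IsGCM A) :
    SerreRelations (zeroBracket R) A (1 : I → Rˣ) :=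
  fun i j hij => by
    obtain ⟨n, hn⟩ : ∃ n, (1 - A i j).toNat = n + 1 :=
      ⟨(1 - A i j).toNat - 1, by have := hA.nonpos i j hij; omega⟩
    rw [hn, Function.iterate_succ_apply']
    rfl

/-- The reflections `r_i` are the operators `s_i` of the zero bracket, so the relations of the Weyl
group for the `r_i` are a special case of those for the `s_i`. -/
lemma weylSeries_zeroBracket (i : I) (f : MvPowerSeries I R) :
    weylSeries (zeroBracket R) hA 1 i f = reflection hA i f := by
  have h : (((X i : MvPowerSeries I R) • vectorField (zeroBracket R) (1 : Rˣ)).toLinearMap :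
      Module.End ℂ (MvPowerSeries I R)) = 0 := by
    refine LinearMap.ext fun g => ?_
    change X i * vectorField (zeroBracket R) (1 : Rˣ) g = 0
    rw [show vectorField (zeroBracket R) (1 : Rˣ) g = 0 from
      MvPowerSeries.ext fun d => smul_zero (((1 : Rˣ)⁻¹ : Rˣ) : R), mul_zero]
  change formalExp (((X i : MvPowerSeries I R) • vectorField (zeroBracket R) (1 : Rˣ)).toLinearMap)
    (reflection hA i f) = _
  ext d
  rw [h, coeff_formalExp, sum_range_succ', sum_eq_zero fun n _ => by simp [pow_succ]]
  simp

lemma reflection_mem_orderIdeal (i : I) {n : ℕ} {f : MvPowerSeries I R}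
    (hf : f ∈ orderIdeal I R n) : reflection hA i f ∈ orderIdeal I R n := by
  induction n generalizing f with
  | zero => exact fun d hd => absurd hd (Nat.not_lt_zero _)
  | succ n ih =>
    refine mem_orderIdeal_succ ?_ fun k => ?_
    · rw [constantCoeff_reflection]
      exact hf 0 (by simp)
    · rw [pderiv_reflection]
      exact sub_mem (ih (pderiv_mem_orderIdeal hf k)) (Ideal.mul_mem_left _ _
        (sum_mem fun j _ => zsmul_mem (ih (pderiv_mem_orderIdeal hf j)) _))

lemma reflection_coeffDer (D : Derivation ℂ R R) (i : I) (f : MvPowerSeries I R) :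
    reflection hA i (coeffDer D f) = coeffDer D (reflection hA i f) := by
  rw [← sub_eq_zero]
  have h0 : ∀ g : MvPowerSeries I R, constantCoeff (coeffDer D g) = D (constantCoeff g) :=
    fun g => rfl
  refine eq_zero_of_pderiv
    (fun g => reflection hA i (coeffDer D g) - coeffDer D (reflection hA i g)) (fun g => ?_)
    (fun n hn g k => ?_) f
  · rw [map_sub, constantCoeff_reflection, h0, h0, constantCoeff_reflection, sub_self]
  · have hX : coeffDer D (pderiv R k (X i : MvPowerSeries I R)) = 0 := by
      by_cases h : i = k
      · rw [h, pderiv_X_self, Derivation.map_one_eq_zero]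
      · rw [pderiv_X_of_ne h, map_zero]
    have e : pderiv R k (reflection hA i (coeffDer D g) - coeffDer D (reflection hA i g)) =
        (reflection hA i (coeffDer D (pderiv R k g)) - coeffDer D (reflection hA i (pderiv R k g)))
        - pderiv R k (X i) * ∑ j ∈ (IsGCM_column_finite hA i).toFinset,
          A j i • (reflection hA i (coeffDer D (pderiv R j g)) -
            coeffDer D (reflection hA i (pderiv R j g))) := by
      simp only [map_sub, pderiv_reflection, pderiv_coeffDer, Derivation.leibniz, hX, smul_eq_mul,
        map_sum, map_zsmul, smul_sub, sum_sub_distrib]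
      ring
    rw [e]
    exact sub_mem (hn _) (Ideal.mul_mem_left _ _ (sum_mem fun j _ => zsmul_mem (hn _) _))

/-- The relation `r_i R_k(t) = R_k(r_i(t)) r_i`, by which the `r`s are moved to the right in a word
in the `s`s. -/
lemma reflection_rOperator (φ : I → Rˣ) (i k : I) {t : MvPowerSeries I R} (ht : constantCoeff t = 0)
    (f : MvPowerSeries I R) :
    reflection hA i (rOperator P φ k t f) =
      rOperator P φ k (reflection hA i t) (reflection hA i f) := by
  have hpow : ∀ n, reflection hA i
      (((t • vectorField P (φ k)).toLinearMap ^ n : Module.End ℂ (MvPowerSeries I R)) f) =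
      ((reflection hA i t • vectorField P (φ k)).toLinearMap ^ n :
        Module.End ℂ (MvPowerSeries I R)) (reflection hA i f) := fun n => by
    induction n with
    | zero => rfl
    | succ n ih =>
      rw [pow_succ', pow_succ', Module.End.mul_apply, Module.End.mul_apply, ← ih]
      refine (map_mul (reflection hA i) t _).trans ?_
      exact congrArg (reflection hA i t * ·) (reflection_coeffDer hA _ i _)
  ext d
  set F : MvPowerSeries I R := ∑ n ∈ range (d.degree + 1), (n.factorial : ℂ)⁻¹ •
    (((t • vectorField P (φ k)).toLinearMap ^ n : Module.End ℂ (MvPowerSeries I R)) f) with hF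
  have hmem : rOperator P φ k t f - F ∈ orderIdeal I R (d.degree + 1) := fun e he => by
    rw [map_sub, sub_eq_zero, rOperator, coeff_formalExp, hF, map_sum]
    refine sum_subset_zero_on_sdiff (range_mono (by omega)) (fun n hn => ?_) fun n _ => rfl
    rw [mem_sdiff, mem_range, mem_range] at hn
    have := coeff_pow_eq_zero (((φ k)⁻¹ : Rˣ).1 • ad P (φ k)) ht f n e (by omega)
    exact (congrArg ((n.factorial : ℂ)⁻¹ • ·) this).trans (smul_zero (n.factorial : ℂ)⁻¹)
  have h := reflection_mem_orderIdeal hA i hmem d (Nat.lt_succ_self _)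
  rw [map_sub, map_sub, sub_eq_zero] at h
  rw [h, rOperator, coeff_formalExp, hF, map_sum, map_sum]
  refine sum_congr rfl fun n _ => ?_
  rw [← hpow]
  have : ∀ (c : ℂ) (g : MvPowerSeries I R), reflection hA i (c • g) = c • reflection hA i g :=
    fun c g => map_smul ((reflection hA i).restrictScalars ℂ) c g
  rw [this]
  rfl

end Reflection

end

/-! ### Moving reflections past exponentials -/

/-- The relations needed to move `ρ = r_i` and `σ = r_j` past `S x y = R_i(xa + yb)` and
`T x y = R_j(xa + yb)`, where `a = λ_i`, `b = λ_j`, `p = a_ij` and `q = a_ji`: the reflection `ρ`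
maps `(x, y)` to `(-x - q y, y)`, and `σ` maps it to `(x, -y - p x)`. -/
structure IsTwist {M : Type*} [Monoid M] (ρ σ : M) (S T : ℤ → ℤ → M) (p q : ℤ) : Prop where
  left_sq : ρ * ρ = 1
  right_sq : σ * σ = 1
  left_mul_fst : ∀ x y, ρ * S x y = S (-x - q * y) y * ρ
  left_mul_snd : ∀ x y, ρ * T x y = T (-x - q * y) y * ρ
  right_mul_fst : ∀ x y, σ * S x y = S x (-y - p * x) * σ
  right_mul_snd : ∀ x y, σ * T x y = T x (-y - p * x) * σ

namespace IsTwist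

variable {M : Type*} [Monoid M] {ρ σ : M} {S T : ℤ → ℤ → M} {p q : ℤ}

lemma isUnit_left (H : IsTwist ρ σ S T p q) : IsUnit ρ :=
  ⟨⟨ρ, ρ, H.left_sq, H.left_sq⟩, rfl⟩

lemma isUnit_right (H : IsTwist ρ σ S T p q) : IsUnit σ :=
  ⟨⟨σ, σ, H.right_sq, H.right_sq⟩, rfl⟩

lemma left_mul_fst_assoc (H : IsTwist ρ σ S T p q) (x y : ℤ) (z : M) :
    ρ * (S x y * z) = S (-x - q * y) y * (ρ * z) := by
  rw [← mul_assoc, H.left_mul_fst, mul_assoc]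

lemma left_mul_snd_assoc (H : IsTwist ρ σ S T p q) (x y : ℤ) (z : M) :
    ρ * (T x y * z) = T (-x - q * y) y * (ρ * z) := by
  rw [← mul_assoc, H.left_mul_snd, mul_assoc]

lemma right_mul_fst_assoc (H : IsTwist ρ σ S T p q) (x y : ℤ) (z : M) :
    σ * (S x y * z) = S x (-y - p * x) * (σ * z) := by
  rw [← mul_assoc, H.right_mul_fst, mul_assoc]

lemma right_mul_snd_assoc (H : IsTwist ρ σ S T p q) (x y : ℤ) (z : M) :
    σ * (T x y * z) = T x (-y - p * x) * (σ * z) := by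
  rw [← mul_assoc, H.right_mul_snd, mul_assoc]

/-- Here and in the next lemmas, `h` and `h'` are the braid relations of the `s`s and of the `r`s;
moving the `r`s to the right in `h` and cancelling them leaves the Yang-Baxter equation. -/
lemma yangBaxter_two (H : IsTwist ρ σ S T 0 0)
    (h : S 1 0 * ρ * (T 0 1 * σ) = T 0 1 * σ * (S 1 0 * ρ)) (h' : ρ * σ = σ * ρ) :
    S 1 0 * T 0 1 = T 0 1 * S 1 0 := by
  refine (H.isUnit_left.mul H.isUnit_right).mul_right_cancel ?_
  conv_rhs => rw [h']
  simpa [mul_assoc, H.left_mul_snd_assoc, H.right_mul_fst_assoc] using h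

lemma yangBaxter_three (H : IsTwist ρ σ S T (-1) (-1))
    (h : S 1 0 * ρ * (T 0 1 * σ) * (S 1 0 * ρ) = T 0 1 * σ * (S 1 0 * ρ) * (T 0 1 * σ))
    (h' : ρ * σ * ρ = σ * ρ * σ) :
    S 1 0 * T 1 1 * S 0 1 = T 0 1 * S 1 1 * T 1 0 := by
  refine ((H.isUnit_left.mul H.isUnit_right).mul H.isUnit_left).mul_right_cancel ?_
  conv_rhs => rw [h']
  simpa [mul_assoc, H.left_mul_fst_assoc, H.left_mul_snd_assoc, H.right_mul_fst_assoc,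
    H.right_mul_snd_assoc] using h

lemma yangBaxter_four (H : IsTwist ρ σ S T (-2) (-1))
    (h : (S 1 0 * ρ * (T 0 1 * σ)) ^ 2 = (T 0 1 * σ * (S 1 0 * ρ)) ^ 2)
    (h' : (ρ * σ) ^ 2 = (σ * ρ) ^ 2) :
    S 1 0 * T 1 1 * S 1 2 * T 0 1 = T 0 1 * S 1 2 * T 1 1 * S 1 0 := by
  refine ((H.isUnit_left.mul H.isUnit_right).pow 2).mul_right_cancel ?_
  conv_rhs => rw [h']
  simpa [sq, mul_assoc, H.left_mul_fst_assoc, H.left_mul_snd_assoc, H.right_mul_fst_assoc,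
    H.right_mul_snd_assoc] using h

lemma yangBaxter_six (H : IsTwist ρ σ S T (-3) (-1))
    (h : (S 1 0 * ρ * (T 0 1 * σ)) ^ 3 = (T 0 1 * σ * (S 1 0 * ρ)) ^ 3)
    (h' : (ρ * σ) ^ 3 = (σ * ρ) ^ 3) :
    S 1 0 * T 1 1 * S 2 3 * T 1 2 * S 1 3 * T 0 1 =
      T 0 1 * S 1 3 * T 1 2 * S 2 3 * T 1 1 * S 1 0 := by
  refine ((H.isUnit_left.mul H.isUnit_right).pow 3).mul_right_cancel ?_
  conv_rhs => rw [h']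
  simpa [pow_three, mul_assoc, H.left_mul_fst_assoc, H.left_mul_snd_assoc, H.right_mul_fst_assoc,
    H.right_mul_snd_assoc] using h

end IsTwist

variable {I R : Type*} [CommRing R] [Algebra ℂ R] (P : PoissonBracket R)
variable {A : Matrix I I ℤ} (hA : IsGCM A) (φ : I → Rˣ)

/-- The reflection `r_i` as a `ℂ`-linear operator on `R[[λ]]`. -/
def reflectionEnd (i : I) : Module.End ℂ (MvPowerSeries I R) :=
  ((reflection hA i).restrictScalars ℂ).toLinearMap

lemma reflectionEnd_eq (i : I) : (reflectionEnd hA i : Module.End ℂ (MvPowerSeries I R)) =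
    (weylSeries (zeroBracket R) hA 1 i).toLinearMap :=
  LinearMap.ext fun f => (weylSeries_zeroBracket hA i f).symm

lemma isTwist_rOperator (i j : I) :
    IsTwist (reflectionEnd hA i) (reflectionEnd hA j)
      (fun x y => rOperator P φ i (x • X i + y • X j))
      (fun x y => rOperator P φ j (x • X i + y • X j)) (A i j) (A j i) := by
  have hsq : ∀ i, reflectionEnd hA i * reflectionEnd hA i =
      (1 : Module.End ℂ (MvPowerSeries I R)) := fun i => by
    rw [reflectionEnd_eq]
    exact congrArg AlgHom.toLinearMap (weylSeries_mul_self (zeroBracket R) hA 1 i)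
  have hcomm : ∀ k l (x y : ℤ), reflectionEnd hA l * rOperator P φ k (x • X i + y • X j) =
      rOperator P φ k (x • (X i - A i l • X l) + y • (X j - A j l • X l)) * reflectionEnd hA l :=
    fun k l x y => LinearMap.ext fun f => by
      refine (reflection_rOperator P hA φ l k (by simp) f).trans ?_
      rw [map_add, map_zsmul, map_zsmul, reflection_X, reflection_X]
      rfl
  have hi : ∀ x y : ℤ, (x • (X i - A i i • X i) + y • (X j - A j i • X i) : MvPowerSeries I R) =
      (-x - A j i * y) • X i + y • X j := fun x y => by
    rw [hA.diag]; module
  have hj : ∀ x y : ℤ, (x • (X i - A i j • X j) + y • (X j - A j j • X j) : MvPowerSeries I R) =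
      x • X i + (-y - A i j * x) • X j := fun x y => by
    rw [hA.diag]; module
  refine ⟨hsq i, hsq j, fun x y => ?_, fun x y => ?_, fun x y => ?_, fun x y => ?_⟩ <;>
    rw [hcomm] <;> simp only [hi, hj]

lemma toLinearMap_weylSeries (i : I) :
    (weylSeries P hA φ i).toLinearMap = rOperator P φ i (X i) * reflectionEnd hA i := rfl

variable {φ}

lemma braid_even (hφ : SerreRelations P A φ) {i j : I} (hij : i ≠ j) {m n : ℕ} (hn : m = n + n)
    (hm : coxeterExponent (A i j * A j i) = m) :
    ((weylSeries P hA φ i).toLinearMap * (weylSeries P hA φ j).toLinearMap) ^ n =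
      ((weylSeries P hA φ j).toLinearMap * (weylSeries P hA φ i).toLinearMap) ^ n := by
  have h := congrArg AlgHom.toEnd (mul_pow_eq_of_pow_eq_one (weylSeries_mul_self P hA φ i)
    (weylSeries_mul_self P hA φ j) hn (weylSeries_mul_pow P hA hφ hij hm))
  simpa only [map_pow, map_mul, AlgHom.toEnd_apply] using h

lemma braid_three (hφ : SerreRelations P A φ) {i j : I} (hij : i ≠ j)
    (hm : coxeterExponent (A i j * A j i) = (3 : ℕ)) :
    (weylSeries P hA φ i).toLinearMap * (weylSeries P hA φ j).toLinearMap *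
        (weylSeries P hA φ i).toLinearMap =
      (weylSeries P hA φ j).toLinearMap * (weylSeries P hA φ i).toLinearMap *
        (weylSeries P hA φ j).toLinearMap := by
  have h := congrArg AlgHom.toEnd (mul_mul_eq_of_pow_three_eq_one (weylSeries_mul_self P hA φ i)
    (weylSeries_mul_self P hA φ j) (weylSeries_mul_pow P hA hφ hij hm))
  simpa only [map_mul, AlgHom.toEnd_apply] using h

lemma reflectionEnd_braid_even {i j : I} (hij : i ≠ j) {m n : ℕ} (hn : m = n + n)
    (hm : coxeterExponent (A i j * A j i) = m) :
    ((reflectionEnd hA i : Module.End ℂ (MvPowerSeries I R)) * reflectionEnd hA j) ^ n =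
      (reflectionEnd hA j * reflectionEnd hA i) ^ n := by
  rw [reflectionEnd_eq, reflectionEnd_eq]
  exact braid_even _ hA (serreRelations_zeroBracket hA) hij hn hm

lemma reflectionEnd_braid_three {i j : I} (hij : i ≠ j)
    (hm : coxeterExponent (A i j * A j i) = (3 : ℕ)) :
    (reflectionEnd hA i : Module.End ℂ (MvPowerSeries I R)) * reflectionEnd hA j *
        reflectionEnd hA i = reflectionEnd hA j * reflectionEnd hA i * reflectionEnd hA j := by
  rw [reflectionEnd_eq, reflectionEnd_eq]
  exact braid_three _ hA (serreRelations_zeroBracket hA) hij hm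

end PoissonWeyl

end

open PoissonWeyl in
theorem theorem3 {I R : Type*} [CommRing R] [Algebra ℂ R] (P : PoissonBracket R)
    {A : Matrix I I ℤ} (hA : IsGCM A) (φ : I → Rˣ) (hφ : PoissonWeyl.SerreRelations P A φ) :
    -- the `s_i` are automorphisms of `R[[λ]][τ^{±1}]`
    (∀ i, Function.Bijective (PoissonWeyl.weyl P hA φ i)) ∧
    -- the fundamental relations of the Weyl group
    (∀ i, PoissonWeyl.weyl P hA φ i ^ 2 = 1) ∧
    (∀ i j, i ≠ j → ∀ m : ℕ, coxeterExponent (A i j * A j i) = m →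
      (PoissonWeyl.weyl P hA φ i * PoissonWeyl.weyl P hA φ j) ^ m = 1) ∧
    -- the Yang-Baxter equations on `R[[λ]]`
    (∀ i j, i ≠ j → ∀ a b : MvPowerSeries I R,
      a = MvPowerSeries.X i → b = MvPowerSeries.X j →
      ∀ S T : MvPowerSeries I R → Module.End ℂ (MvPowerSeries I R),
      S = PoissonWeyl.rOperator P φ i → T = PoissonWeyl.rOperator P φ j →
      ((A i j = 0 ∧ A j i = 0) → S a * T b = T b * S a) ∧
      ((A i j = -1 ∧ A j i = -1) → S a * T (a + b) * S b = T b * S (a + b) * T a) ∧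
      ((A i j = -2 ∧ A j i = -1) →
        S a * T (a + b) * S (a + 2 * b) * T b = T b * S (a + 2 * b) * T (a + b) * S a) ∧
      ((A i j = -3 ∧ A j i = -1) →
        S a * T (a + b) * S (2 * a + 3 * b) * T (a + 2 * b) * S (a + 3 * b) * T b =
          T b * S (a + 3 * b) * T (a + 2 * b) * S (2 * a + 3 * b) * T (a + b) * S a)) := by
  have hinv : ∀ i, Function.Involutive (weyl P hA φ i) := fun i =>
    DFunLike.congr_fun (weyl_mul_self P hA φ i)
  refine ⟨fun i => (hinv i).bijective, fun i => (sq _).trans (weyl_mul_self P hA φ i),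
    fun i j hij m hm => weyl_mul_pow P hA hφ hij hm, fun i j hij a b ha hb S T hS hT => ?_⟩
  subst ha hb hS hT
  have H := isTwist_rOperator P hA φ i j
  -- the integer coordinates of the linear forms that occur
  have h10 : ((1 : ℤ) • MvPowerSeries.X i + (0 : ℤ) • MvPowerSeries.X j : MvPowerSeries I R) =
      MvPowerSeries.X i := by simp
  have h01 : ((0 : ℤ) • MvPowerSeries.X i + (1 : ℤ) • MvPowerSeries.X j : MvPowerSeries I R) =
      MvPowerSeries.X j := by simp
  refine ⟨fun ⟨hp, hq⟩ => ?_, fun ⟨hp, hq⟩ => ?_, fun ⟨hp, hq⟩ => ?_, fun ⟨hp, hq⟩ => ?_⟩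
  · have hm : coxeterExponent (A i j * A j i) = (2 : ℕ) := by simp [hp, hq, coxeterExponent]
    have h := braid_even P hA hφ hij (n := 1) rfl hm
    have h' := reflectionEnd_braid_even (R := R) hA hij (n := 1) rfl hm
    rw [pow_one, pow_one] at h h'
    rw [toLinearMap_weylSeries, toLinearMap_weylSeries] at h
    rw [hp, hq] at H
    have := H.yangBaxter_two (by simpa only [h10, h01] using h) h'
    simpa only [h10, h01] using this
  · have hm : coxeterExponent (A i j * A j i) = (3 : ℕ) := by simp [hp, hq, coxeterExponent]
    have h := braid_three P hA hφ hij hm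
    rw [toLinearMap_weylSeries, toLinearMap_weylSeries] at h
    rw [hp, hq] at H
    have := H.yangBaxter_three (by simpa only [h10, h01] using h)
      (reflectionEnd_braid_three hA hij hm)
    simpa only [h10, h01, one_smul, zero_smul, add_zero, zero_add] using this
  · have hm : coxeterExponent (A i j * A j i) = (4 : ℕ) := by simp [hp, hq, coxeterExponent]
    have h := braid_even P hA hφ hij (n := 2) rfl hm
    rw [toLinearMap_weylSeries, toLinearMap_weylSeries] at h
    rw [hp, hq] at H
    have := H.yangBaxter_four (by simpa only [h10, h01] using h)
      (reflectionEnd_braid_even hA hij rfl hm)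
    simpa only [h10, h01, one_smul, zsmul_eq_mul, Int.cast_ofNat, Int.cast_zero, zero_mul,
      add_zero, zero_add] using this
  · have hm : coxeterExponent (A i j * A j i) = (6 : ℕ) := by simp [hp, hq, coxeterExponent]
    have h := braid_even P hA hφ hij (n := 3) rfl hm
    rw [toLinearMap_weylSeries, toLinearMap_weylSeries] at h
    rw [hp, hq] at H
    have := H.yangBaxter_six (by simpa only [h10, h01] using h)
      (reflectionEnd_braid_even hA hij rfl hm)
    simpa only [h10, h01, one_smul, zsmul_eq_mul, Int.cast_ofNat, Int.cast_zero, zero_mul,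
      add_zero, zero_add] using this
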